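/- Let $d\ge 2$, $n=d+2$, $0<\alpha<n$, $1<q\le n/\alpha$, $q'=q/(q-1)$. A *time-backward parabolic rectangle* with sidelength $\ell_R=\ell$ is a set $R=Q\times(t-\ell^2,t)\subset\mathbb R^{d}\times\mathbb R$, where $Q\subset\mathbb R^d$ is an open cube of sidelength $\ell>0$ with edges parallel to the axes; write $\delta_3R=3Q\times(t-9\ell^2,t+9\ell^2)$, with $3Q$ concentric to $Q$. Its dyadic tree $\mathfrak D(R)$ consists of the rectangles of sidelength $2^{-j}\ell$, $j\ge 0$, obtained by repeatedly halving the sides of $Q$ and cutting the time interval into four equal parts. Let $\mathscr D$ be a *parabolic dyadic lattice*: a collection of such rectangles with (i) $\mathfrak D(R)\subset\mathscr D$ for all $R\in\mathscr D$; (ii) any two elements of $\mathscr D$ lie in $\mathfrak D(R)$ for some $R\in\mathscr D$; (iii) each compact subset of $\mathbb R^d\times(0,\infty)$ is contained in some $R\in\mathscr D$. (Lattices that exhaust all of $\mathbb R^{d+1}$ are included.) For $R\in\mathscr D$ let $\eta_R\in C_c^\infty(\mathbb R^{d+1})$ with $\mathbf 1_R\le\eta_R\le\mathbf 1_{\delta_3R}$.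 Let $\mathfrak M^+$ be the set of nonnegative Radon measures on $\mathbb R^{d+1}$ and $\mathfrak M^+(E)=\{\mu\in\mathfrak M^+:\mu(E^c)=0\}$. For $\mu\in\mathfrak M^+$ put $$\mathcal W\mu(z)=\sum_{R\in\mathscr D,\ \ell_R<1}\Big(\ell_R^{\alpha q-n}\int\eta_R\,d\mu\Big)^{q'-1}\eta_R(z),\qquad \mathcal E\mu=\int\mathcal W\mu\,d\mu .$$ For compact $K$ define $\mathscr C(K)\in[0,\infty]$ by $\mathscr C(K)^{1/q}=\sup\{\mu(\mathbb R^{d+1}):\mu\in\mathfrak M^+(K),\ \mathcal E\mu\le 1\}$. For arbitrary $E$ put $\mathscr C_*(E)=\sup\{\mathscr C(K):K\subset E\text{ compact}\}$ and define the (extended) capacity $\mathscr C(E)=\inf\{\mathscr C_*(U):U\supset E\text{ open}\}$. A property holds $\mathscr C$-a.e. on $E$ if it fails on a subset of $E$ of (extended) capacity zero. Then the following hold (infima and suprema being taken in $[0,\infty]$). **Compact sets** (here $\mathscr C(K)$ is the capacity as defined for compact sets). (A) If $\mu\in\mathfrak M^+$, $\mathcal E\mu<\infty$ and $\vartheta>0$,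 then $\mathscr C(K)\le\vartheta^{-q}\mathcal E\mu$ for every compact $K\subset\{\mathcal W\mu>\vartheta\}$; in particular $\mathscr C(\{\mathcal W\mu>\vartheta\})\le\vartheta^{-q}\mathcal E\mu$. (B) For every compact $K$, $\mathscr C(K)=\inf\{\mathcal E\mu:\mu\in\mathfrak M^+,\ \mathcal W\mu\ge1\ \mathscr C\text{-a.e. on }K\}$. (C) For every compact $K$, $\mathscr C(K)=\sup\{\mu(K):\mu\in\mathfrak M^+(K),\ \mathcal W\mu\le1\text{ on }\operatorname{spt}\mu\}$. **Arbitrary sets** (here $\mathscr C(E)$ is the extended capacity). (A') If $\mu\in\mathfrak M^+$, $\mathcal E\mu<\infty$ and $\vartheta>0$, then $\mathscr C(E)\le\vartheta^{-q}\mathcal E\mu$ for every set $E\subset\{\mathcal W\mu>\vartheta\}$. (B') For every set $E\subset\mathbb R^{d+1}$, $\mathscr C(E)=\inf\{\mathcal E\mu:\mu\in\mathfrak M^+,\ \mathcal W\mu\ge1\ \mathscr C\text{-a.e. on }E\}$. (C') For every set $E\subset\mathbb R^{d+1}$, $\sup\{\mu(E):\mu\in\mathfrak M^+(E),\ \mathcal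 W\mu\le1\text{ on }\operatorname{spt}\mu\}=\mathscr C_*(E)$, and this is equal to $\mathscr C(E)$ whenever $E$ is analytic (Suslin), in particular whenever $E$ is Borel. -/

import Mathlib

open MeasureTheory Set
open scoped ENNReal ContDiff

namespace ParabolicCapacity

/-- Space-time `ℝ^{d+1} = ℝ^d × ℝ`; a point is a pair `(x, t)`. -/
abbrev SpaceTime (d : ℕ) : Type := EuclideanSpace ℝ (Fin d) × ℝ

/-- The data of a time-backward parabolic rectangle `R⁻ = Q × (t - ℓ², t)`: the lower corner of
the cube `Q` with edges parallel to the axes, the final time `t`, and the sidelength `ℓ > 0`. -/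
structure Rect (d : ℕ) where
  corner : Fin d → ℝ
  time : ℝ
  side : ℝ
  side_pos : 0 < side

variable {d : ℕ}

/-- The open set `Q × (t - ℓ², t)`. -/
def Rect.toSet (R : Rect d) : Set (SpaceTime d) :=
  {z | (∀ i, R.corner i < z.1 i ∧ z.1 i < R.corner i + R.side) ∧
    R.time - R.side ^ 2 < z.2 ∧ z.2 < R.time}

/-- The parabolic dilation `c Q × (t - c² ℓ², t + c² ℓ²)`, where `c Q` is the cube with the same
centre as `Q` and sidelength `c ℓ`. -/
def Rect.dilate (c : ℝ) (R : Rect d) : Set (SpaceTime d) :=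
  {z | (∀ i, |z.1 i - (R.corner i + R.side / 2)| < c * R.side / 2) ∧
    R.time - c ^ 2 * R.side ^ 2 < z.2 ∧ z.2 < R.time + c ^ 2 * R.side ^ 2}

/-- The dyadic tree of `Q`: `R` is one of the `2^{j(d+2)}` rectangles of sidelength `2^{-j} ℓ`
obtained by subdividing `Q` for some `j ≥ 0`, halving the spatial sides and quartering the time
interval at each step. -/
def Rect.IsDyadicSub (R Q : Rect d) : Prop :=
  ∃ j : ℕ, R.side = Q.side / 2 ^ j ∧
    (∀ i, ∃ k : ℕ, k < 2 ^ j ∧ R.corner i = Q.corner i + k * R.side) ∧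
    ∃ m : ℕ, m < 4 ^ j ∧ R.time = Q.time - m * R.side ^ 2

/-- Parabolic dyadic lattices in the sense of Lerner and Nazarov. The rectangles need not lie in
the half-space `t > 0`, so lattices exhausting all of `ℝ^{d+1}` are included. -/
structure IsLattice (𝒟 : Set (Rect d)) : Prop where
  sub_mem : ∀ Q ∈ 𝒟, ∀ R : Rect d, R.IsDyadicSub Q → R ∈ 𝒟
  common : ∀ Q' ∈ 𝒟, ∀ Q'' ∈ 𝒟, ∃ Q ∈ 𝒟, Q'.IsDyadicSub Q ∧ Q''.IsDyadicSub Q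
  exhaust : ∀ K : Set (SpaceTime d), IsCompact K → K ⊆ {z | 0 < z.2} → ∃ Q ∈ 𝒟, K ⊆ Q.toSet

/-- `φ ∈ C_c^∞(ℝ^{d+1})` and `1_R ≤ φ ≤ 1_{δ₃ R}`. -/
structure IsCutoff (R : Rect d) (φ : SpaceTime d → ℝ) : Prop where
  smooth : ContDiff ℝ ∞ φ
  compact : HasCompactSupport φ
  lower : ∀ z, R.toSet.indicator (fun _ => (1 : ℝ)) z ≤ φ z
  upper : ∀ z, φ z ≤ (R.dilate 3).indicator (fun _ => (1 : ℝ)) z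

/-- The nonnegative Radon measures on `ℝ^{d+1}`: the locally finite Borel measures. -/
def radon (d : ℕ) : Set (Measure (SpaceTime d)) := {μ | IsLocallyFiniteMeasure μ}

/-- The nonnegative Radon measures carried by `E`. -/
def radonOn (E : Set (SpaceTime d)) : Set (Measure (SpaceTime d)) :=
  {μ | μ ∈ radon d ∧ μ Eᶜ = 0}

section Capacity

variable (𝒟 : Set (Rect d)) (η : Rect d → SpaceTime d → ℝ) (α q : ℝ)

/-- The regularized dyadic Wolff potential
`∑_{R ∈ 𝒟, ℓ_R < 1} (ℓ_R^{αq - n} μ(η_R))^{q' - 1} η_R(z)`, where `n = d + 2`. -/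
noncomputable def wolff (μ : Measure (SpaceTime d)) (z : SpaceTime d) : ℝ≥0∞ :=
  ∑' R : {R : Rect d // R ∈ 𝒟 ∧ R.side < 1},
    (ENNReal.ofReal (R.1.side ^ (α * q - ((d : ℝ) + 2))) *
        ∫⁻ w, ENNReal.ofReal (η R.1 w) ∂μ) ^ (q.conjExponent - 1) *
      ENNReal.ofReal (η R.1 z)

/-- The energy `ℰ μ = ∫ 𝒲 μ dμ`. -/
noncomputable def energy (μ : Measure (SpaceTime d)) : ℝ≥0∞ :=
  ∫⁻ z, wolff 𝒟 η α q μ z ∂μ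

/-- The capacity of a compact set:
`𝒞(K)^{1/q} = sup {‖μ‖ : μ a Radon measure carried by K, ℰ μ ≤ 1}`. -/
noncomputable def capCompact (K : Set (SpaceTime d)) : ℝ≥0∞ :=
  (⨆ μ ∈ {μ ∈ radonOn K | energy 𝒟 η α q μ ≤ 1}, μ univ) ^ q

/-- The inner capacity of a set: the supremum of the capacities of its compact subsets. -/
noncomputable def capInner (E : Set (SpaceTime d)) : ℝ≥0∞ :=
  ⨆ K ∈ {K : Set (SpaceTime d) | IsCompact K ∧ K ⊆ E}, capCompact 𝒟 η α q K

/-- The capacity of an arbitrary set: inner regular on open sets, and extended to all sets by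
outer regularity. -/
noncomputable def cap (E : Set (SpaceTime d)) : ℝ≥0∞ :=
  ⨅ U ∈ {U : Set (SpaceTime d) | IsOpen U ∧ E ⊆ U}, capInner 𝒟 η α q U

/-- `𝒲 μ ≥ 1` holds quasi-everywhere on `E`: the exceptional subset of `E` has capacity zero. -/
def WolffGeOneQE (μ : Measure (SpaceTime d)) (E : Set (SpaceTime d)) : Prop :=
  cap 𝒟 η α q {z ∈ E | wolff 𝒟 η α q μ z < 1} = 0

/-- The set `{𝒲 μ > ϑ}`. -/
def superlevel (μ : Measure (SpaceTime d)) (ϑ : ℝ) : Set (SpaceTime d) :=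
  {z | ENNReal.ofReal ϑ < wolff 𝒟 η α q μ z}

/-- The infimum of `ℰ μ` over the Radon measures `μ` with `𝒲 μ ≥ 1` quasi-everywhere on `E`. -/
noncomputable def infEnergy (E : Set (SpaceTime d)) : ℝ≥0∞ :=
  ⨅ μ ∈ {μ ∈ radon d | WolffGeOneQE 𝒟 η α q μ E}, energy 𝒟 η α q μ

/-- The supremum of `μ(E)` over the Radon measures `μ` carried by `E` with `𝒲 μ ≤ 1` on the
support of `μ`. -/
noncomputable def supMass (E : Set (SpaceTime d)) : ℝ≥0∞ :=
  ⨆ μ ∈ {μ ∈ radonOn E | ∀ z ∈ μ.support, wolff 𝒟 η α q μ z ≤ 1}, μ E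

end Capacity

end ParabolicCapacity

/-!
The statement is a piece of nonlinear potential theory for a kernel given by countably many
functions. Let `φ_i ≥ 0` be continuous with compact support, `w_i > 0` weights and `q, p` conjugate
exponents. With `b_i = ∫ φ_i dμ`, the potential is `W μ = ∑ w_i b_i ^ (p - 1) φ_i` and the energy is
`ℰ μ = ∑ w_i b_i ^ p`. The cutoffs of the rectangles of sidelength less than one in the lattice,
with `w_R = (ℓ_R ^ (αq - n)) ^ (p - 1)`, are such a family (`ParabolicCapacity.latticeKernel`).

Hölder's inequality gives `∫ ∑ w_i f_i φ_i dν ≤ (∑ w_i f_i ^ q) ^ (1/q) (ℰ ν) ^ (1/p)`, and hence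
the weak-type bound (`PotentialKernel.cap_superlevel_le`). For a compact set `K` of finite capacity
a measure of maximal mass among those on `K` of energy at most one exists by vague compactness; its
first variation shows that a multiple `μ` of it satisfies `ν K ≤ ∫ W μ dν` for all `ν` on `K` of
finite energy, has `W μ ≤ 1` on its support, and has mass equal to `𝒞(K)`, which also bounds its
energy (`PotentialKernel.exists_extremal`). Restricting such measures yields the countable
subadditivity of the capacity (`PotentialKernel.cap_iUnion_le`). Together with outer regularity on
compact sets (`PotentialKernel.cap_of_isCompact`) this turns the inequality in the mean into
`W μ ≥ 1` quasi-everywhere (`PotentialKernel.cap_pot_lt_one_eq_zero`).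

An open set `U` of finite capacity is exhausted by compact sets, and a vague limit of their extremal
measures has `W ≥ 1` quasi-everywhere on `U` and energy at most `𝒞(U)`
(`PotentialKernel.exists_wolff_ge_one_of_isOpen`). The masses stay locally bounded except possibly
near the blind points, where all `φ_i` vanish. Blind points lie outside the closure of the union of
the rectangles, and can occur when the lattice does not exhaust the whole space; near such a point
only finitely many `φ_i` are nonzero (`ParabolicCapacity.finite_cutoffs_near`), so that the capacity
of a single point tends to infinity there and a set of finite capacity stays away from it.

This gives the formula for the capacity as an infimum of energies; the one for the inner capacity as
a supremum of masses follows from the extremal measures of compact sets and, where the capacity is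
infinite, from large point masses at blind points.

For analytic sets Choquet's argument needs that the capacity is continuous along increasing
sequences of arbitrary sets (`PotentialKernel.cap_iUnion_of_monotone`). If `f_n` is almost optimal
for `E_n`, the averages `(f_n + f_m) / 2` are admissible for the smaller of the two sets, and the
uniform convexity of `x ↦ x ^ q` makes `f_n ^ q` a Cauchy sequence in weighted `ℓ¹`; the supremum
of a fast subsequence is then admissible for the union and almost optimal.
-/

/-! ### Potentials, energies and capacities of a kernel -/

section

open Filter Topology
open scoped NNReal CompactlySupported

/-- The data of a nonlinear potential theory: a family of nonnegative continuous functions of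
compact support with positive weights, and an exponent `q > 1`. The last field requires that a point
where all functions vanish has a neighbourhood on which all but finitely many vanish identically. -/
structure PotentialKernel (X ι : Type*) [TopologicalSpace X] where
  weight : ι → ℝ≥0
  weight_pos : ∀ i, 0 < weight i
  fn : ι → C_c(X, ℝ≥0)
  q : ℝ
  one_lt : 1 < q
  finite_near : ∀ z, (∀ i, fn i z = 0) → ∃ V ∈ 𝓝 z, {i | ∃ y ∈ V, fn i y ≠ 0}.Finite

namespace PotentialKernel

variable {X ι : Type*} [TopologicalSpace X] (k : PotentialKernel X ι)

/-- The exponent conjugate to `q`. -/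
noncomputable def p : ℝ := k.q.conjExponent

lemma holderConjugate : k.q.HolderConjugate k.p := .conjExponent k.one_lt

lemma one_lt_p : 1 < k.p := k.holderConjugate.symm.lt

lemma p_pos : 0 < k.p := k.holderConjugate.symm.pos

lemma q_pos : 0 < k.q := k.holderConjugate.pos

lemma p_sub_one_pos : 0 < k.p - 1 := sub_pos.2 k.one_lt_p

lemma p_sub_one_mul_q : (k.p - 1) * k.q = k.p := by
  have h1 := k.holderConjugate.mul_eq_add
  linarith

lemma q_sub_one_mul_p : (k.q - 1) * k.p = k.q := by
  have h1 := k.holderConjugate.mul_eq_add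
  linarith

lemma p_sub_one_mul_q_sub_one : (k.p - 1) * (k.q - 1) = 1 := by
  have h1 := k.holderConjugate.mul_eq_add
  linarith

lemma inv_p_add_inv_q : k.p⁻¹ + k.q⁻¹ = 1 := k.holderConjugate.symm.inv_add_inv_eq_one

lemma continuous_fn (i : ι) : Continuous fun z => (k.fn i z : ℝ≥0∞) :=
  ENNReal.continuous_coe.comp (k.fn i).continuous

/-- The linear potential `∑ w_i f_i φ_i` of a sequence `f`. -/
noncomputable def pot (f : ι → ℝ≥0∞) (z : X) : ℝ≥0∞ := ∑' i, k.weight i * f i * k.fn i z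

/-- The `q`-th power `∑ w_i f_i ^ q` of the weighted `ℓ^q` norm. -/
noncomputable def modular (f : ι → ℝ≥0∞) : ℝ≥0∞ := ∑' i, k.weight i * f i ^ k.q

lemma lowerSemicontinuous_pot (f : ι → ℝ≥0∞) (hf : ∀ i, f i ≠ ⊤) :
    LowerSemicontinuous (k.pot f) := by
  refine lowerSemicontinuous_tsum fun i => Continuous.lowerSemicontinuous ?_
  exact ENNReal.continuous_const_mul (ENNReal.mul_ne_top ENNReal.coe_ne_top (hf i))
    |>.comp (k.continuous_fn i)

lemma pot_mono {f g : ι → ℝ≥0∞} (h : ∀ i, f i ≤ g i) (z : X) : k.pot f z ≤ k.pot g z :=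
  ENNReal.tsum_le_tsum fun i => by gcongr; exact h i

lemma ne_top_of_modular {f : ι → ℝ≥0∞} (h : k.modular f ≠ ⊤) (i : ι) : f i ≠ ⊤ := by
  intro hi
  apply h
  refine ENNReal.tsum_eq_top_of_eq_top ⟨i, ?_⟩
  rw [hi, ENNReal.top_rpow_of_pos k.q_pos, ENNReal.mul_top]
  exact_mod_cast (k.weight_pos i).ne'

lemma modular_rpow_p_sub_one (b : ι → ℝ≥0∞) :
    k.modular (fun i => b i ^ (k.p - 1)) = ∑' i, k.weight i * b i ^ k.p := by
  simp only [modular, ← ENNReal.rpow_mul, k.p_sub_one_mul_q]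

lemma pot_smul (a : ℝ≥0∞) (f : ι → ℝ≥0∞) (z : X) :
    k.pot (fun i => a * f i) z = a * k.pot f z := by
  simp only [pot, ← ENNReal.tsum_mul_left]
  exact tsum_congr fun i => by ring

lemma pot_add (f g : ι → ℝ≥0∞) (z : X) :
    k.pot (fun i => f i + g i) z = k.pot f z + k.pot g z := by
  simp only [pot, ← ENNReal.tsum_add]
  exact tsum_congr fun i => by ring

section

variable [Countable ι]

/-- Hölder's inequality with respect to the weights of the kernel. -/
lemma tsum_mul_le (f b : ι → ℝ≥0∞) :
    ∑' i, k.weight i * f i * b i ≤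
      k.modular f ^ (1 / k.q) * (∑' i, k.weight i * b i ^ k.p) ^ (1 / k.p) := by
  let _ : MeasurableSpace ι := ⊤
  have key : ∀ g : ι → ℝ≥0∞,
      ∫⁻ i, g i ∂(Measure.count.withDensity fun i => (k.weight i : ℝ≥0∞)) =
        ∑' i, k.weight i * g i := fun g => by
    rw [lintegral_withDensity_eq_lintegral_mul _ measurable_from_top measurable_from_top,
      lintegral_count]
    rfl
  have := ENNReal.lintegral_mul_le_Lp_mul_Lq
    (Measure.count.withDensity fun i => (k.weight i : ℝ≥0∞)) k.holderConjugate
    (f := f) (g := b) measurable_from_top.aemeasurable measurable_from_top.aemeasurable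
  simpa only [key, Pi.mul_apply, ← mul_assoc, modular] using this

/-- Hölder's inequality applied to the tail of the sum only. -/
lemma tsum_mul_le_sum_add {s : Finset ι} (f b : ι → ℝ≥0∞) :
    ∑' i, k.weight i * f i * b i ≤ ∑ i ∈ s, k.weight i * f i * b i +
      k.modular f ^ (1 / k.q) * (∑' i : {i // i ∉ s}, k.weight i * b i ^ k.p) ^ (1 / k.p) := by
  rw [← Summable.tsum_add_tsum_compl (s := (s : Set ι)) ENNReal.summable ENNReal.summable,
    Finset.tsum_subtype' s fun i => k.weight i * f i * b i]
  refine add_le_add_right ?_ _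
  have h1 := k.tsum_mul_le f ((sᶜ : Set ι).indicator b)
  have h2 : ∑' i, k.weight i * f i * (sᶜ : Set ι).indicator b i =
      ∑' i : ((sᶜ : Set ι) : Type _), k.weight i * f i * b i := by
    rw [tsum_subtype (sᶜ : Set ι) fun i => k.weight i * f i * b i]
    refine tsum_congr fun i => ?_
    by_cases hi : i ∈ (sᶜ : Set ι) <;> simp [indicator, hi]
  have h3 : ∑' i, k.weight i * (sᶜ : Set ι).indicator b i ^ k.p =
      ∑' i : ((sᶜ : Set ι) : Type _), k.weight i * b i ^ k.p := by
    rw [tsum_subtype (sᶜ : Set ι) fun i => k.weight i * b i ^ k.p]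
    refine tsum_congr fun i => ?_
    by_cases hi : i ∈ (sᶜ : Set ι) <;> simp [indicator, hi, k.p_pos]
  rw [h2, h3] at h1
  exact h1

end

variable [MeasurableSpace X]

/-- The integrals `∫ φ_i dμ` of the functions of the kernel. -/
noncomputable def coeff (μ : Measure X) (i : ι) : ℝ≥0∞ := ∫⁻ z, k.fn i z ∂μ

/-- The nonlinear potential `∑ w_i (∫ φ_i dμ) ^ (p - 1) φ_i`. -/
noncomputable def wolff (μ : Measure X) (z : X) : ℝ≥0∞ :=
  k.pot (fun i => k.coeff μ i ^ (k.p - 1)) z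

/-- The energy `∫ W μ dμ = ∑ w_i (∫ φ_i dμ) ^ p`. -/
noncomputable def energy (μ : Measure X) : ℝ≥0∞ := ∫⁻ z, k.wolff μ z ∂μ

lemma coeff_mono {μ ν : Measure X} (h : μ ≤ ν) (i : ι) : k.coeff μ i ≤ k.coeff ν i :=
  lintegral_mono' h le_rfl

lemma coeff_smul (a : ℝ≥0∞) (μ : Measure X) (i : ι) : k.coeff (a • μ) i = a * k.coeff μ i := by
  simp [coeff]

lemma coeff_add (μ ν : Measure X) (i : ι) : k.coeff (μ + ν) i = k.coeff μ i + k.coeff ν i := by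
  simp [coeff]

lemma wolff_mono {μ ν : Measure X} (h : μ ≤ ν) (z : X) : k.wolff μ z ≤ k.wolff ν z :=
  k.pot_mono (fun i => ENNReal.rpow_le_rpow (k.coeff_mono h i) k.p_sub_one_pos.le) z

lemma energy_mono {μ ν : Measure X} (h : μ ≤ ν) : k.energy μ ≤ k.energy ν :=
  lintegral_mono' h (k.wolff_mono h)

/-- The largest mass of a Radon measure carried by `K` with energy at most one; it is the `q`-th
root of the capacity. -/
noncomputable def massBound (K : Set X) : ℝ≥0∞ :=
  ⨆ μ ∈ {μ : Measure X | (IsLocallyFiniteMeasure μ ∧ μ Kᶜ = 0) ∧ k.energy μ ≤ 1}, μ univ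

/-- The capacity, as defined on compact sets. -/
noncomputable def capCompact (K : Set X) : ℝ≥0∞ := k.massBound K ^ k.q

/-- The inner capacity. -/
noncomputable def capInner (E : Set X) : ℝ≥0∞ :=
  ⨆ K ∈ {K : Set X | IsCompact K ∧ K ⊆ E}, k.capCompact K

/-- The capacity of an arbitrary set, defined by outer regularity from the inner capacity of open
sets. -/
noncomputable def cap (E : Set X) : ℝ≥0∞ :=
  ⨅ U ∈ {U : Set X | IsOpen U ∧ E ⊆ U}, k.capInner U

lemma le_massBound {K : Set X} (μ : Measure X) [IsLocallyFiniteMeasure μ] (h : μ Kᶜ = 0)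
    (he : k.energy μ ≤ 1) : μ univ ≤ k.massBound K :=
  le_iSup₂_of_le μ ⟨⟨inferInstance, h⟩, he⟩ le_rfl

lemma massBound_eq (K : Set X) : k.massBound K = k.capCompact K ^ (1 / k.q) := by
  rw [capCompact, ← ENNReal.rpow_mul, mul_one_div_cancel k.q_pos.ne', ENNReal.rpow_one]

lemma capCompact_eq_top_iff {K : Set X} : k.capCompact K = ⊤ ↔ k.massBound K = ⊤ := by
  rw [capCompact, ENNReal.rpow_eq_top_iff_of_pos k.q_pos]

lemma capCompact_le_capInner {K E : Set X} (hK : IsCompact K) (h : K ⊆ E) :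
    k.capCompact K ≤ k.capInner E := le_iSup₂_of_le K ⟨hK, h⟩ le_rfl

lemma capInner_mono {E F : Set X} (h : E ⊆ F) : k.capInner E ≤ k.capInner F :=
  iSup₂_le fun _ hK => k.capCompact_le_capInner hK.1 (hK.2.trans h)

lemma cap_mono {E F : Set X} (h : E ⊆ F) : k.cap E ≤ k.cap F :=
  le_iInf₂ fun U hU => iInf₂_le U ⟨hU.1, h.trans hU.2⟩

lemma capInner_le_cap (E : Set X) : k.capInner E ≤ k.cap E :=
  le_iInf₂ fun _ hU => k.capInner_mono hU.2

lemma cap_of_isOpen {U : Set X} (hU : IsOpen U) : k.cap U = k.capInner U :=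
  le_antisymm (iInf₂_le U ⟨hU, Subset.rfl⟩) (k.capInner_le_cap U)

lemma exists_isOpen_capInner_lt {E : Set X} {r : ℝ≥0∞} (h : k.cap E < r) :
    ∃ U, IsOpen U ∧ E ⊆ U ∧ k.capInner U < r := by
  obtain ⟨U, hU⟩ := iInf_lt_iff.1 h
  obtain ⟨h1, h2⟩ := iInf_lt_iff.1 hU
  exact ⟨U, h1.1, h1.2, h2⟩

lemma cap_eq_zero_of_subset {E F : Set X} (h : E ⊆ F) (hF : k.cap F = 0) : k.cap E = 0 :=
  le_antisymm ((k.cap_mono h).trans hF.le) zero_le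

lemma wolff_smul (a : ℝ≥0∞) (μ : Measure X) (z : X) :
    k.wolff (a • μ) z = a ^ (k.p - 1) * k.wolff μ z := by
  simp only [wolff, coeff_smul, ENNReal.mul_rpow_of_nonneg _ _ k.p_sub_one_pos.le, pot_smul]

variable [OpensMeasurableSpace X]

lemma measurable_fn (i : ι) : Measurable fun z => (k.fn i z : ℝ≥0∞) :=
  (k.continuous_fn i).measurable

lemma coeff_ne_top (μ : Measure X) [IsFiniteMeasureOnCompacts μ] (i : ι) : k.coeff μ i ≠ ⊤ := by
  have h : Integrable (fun z => (k.fn i z : ℝ)) μ :=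
    Continuous.integrable_of_hasCompactSupport (by fun_prop)
      ((k.fn i).hasCompactSupport.comp_left rfl)
  have h2 := (hasFiniteIntegral_iff_enorm.1 h.2).ne
  simpa only [coeff, NNReal.enorm_eq] using h2

lemma lowerSemicontinuous_wolff (μ : Measure X) [IsFiniteMeasureOnCompacts μ] :
    LowerSemicontinuous (k.wolff μ) :=
  k.lowerSemicontinuous_pot _ fun i =>
    ENNReal.rpow_ne_top_of_nonneg k.p_sub_one_pos.le (k.coeff_ne_top μ i)

variable [Countable ι]

lemma lintegral_pot (f : ι → ℝ≥0∞) (ν : Measure X) :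
    ∫⁻ z, k.pot f z ∂ν = ∑' i, k.weight i * f i * k.coeff ν i := by
  simp only [pot]
  rw [lintegral_tsum fun i => ((k.measurable_fn i).const_mul _).aemeasurable]
  exact tsum_congr fun i => lintegral_const_mul _ (k.measurable_fn i)

lemma measurable_pot (f : ι → ℝ≥0∞) : Measurable (k.pot f) :=
  Measurable.tsum fun i => (k.measurable_fn i).const_mul _

lemma energy_eq (μ : Measure X) : k.energy μ = ∑' i, k.weight i * k.coeff μ i ^ k.p := by
  simp only [energy, wolff, lintegral_pot]
  refine tsum_congr fun i => ?_
  rw [mul_assoc]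
  congr 1
  conv_lhs => rw [← ENNReal.rpow_one (k.coeff μ i), ← ENNReal.rpow_mul, one_mul]
  rw [← ENNReal.rpow_add_of_nonneg _ _ k.p_sub_one_pos.le zero_le_one]
  congr 1; ring

lemma energy_smul (a : ℝ≥0∞) (μ : Measure X) : k.energy (a • μ) = a ^ k.p * k.energy μ := by
  simp only [energy_eq, coeff_smul, ENNReal.mul_rpow_of_nonneg _ _ k.p_pos.le,
    ← ENNReal.tsum_mul_left]
  exact tsum_congr fun i => by ring

lemma modular_wolff (μ : Measure X) :
    k.modular (fun i => k.coeff μ i ^ (k.p - 1)) = k.energy μ := by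
  rw [modular_rpow_p_sub_one, energy_eq]

/-- The mixed energy estimate. -/
theorem lintegral_pot_le (f : ι → ℝ≥0∞) (ν : Measure X) :
    ∫⁻ z, k.pot f z ∂ν ≤ k.modular f ^ (1 / k.q) * k.energy ν ^ (1 / k.p) := by
  rw [lintegral_pot, energy_eq]
  exact k.tsum_mul_le f _
end PotentialKernel
end

/-! ### Vague limits of measures, and scaling of the energy -/

section

open Filter Topology
open scoped NNReal CompactlySupported

section VagueLimit

variable {X : Type*} [MetricSpace X] [ProperSpace X]

lemma exists_compactlySupported_one {K V : Set X} (hK : IsCompact K) (hV : IsOpen V)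
    (hKV : K ⊆ V) :
    ∃ f : C_c(X, ℝ≥0), (∀ x ∈ K, f x = 1) ∧ (∀ x ∉ V, f x = 0) ∧ ∀ x, f x ≤ 1 := by
  obtain ⟨f, h1, h2, h3, h4⟩ := exists_continuousMap_one_of_isCompact_subset_isOpen hK hV hKV
  refine ⟨⟨⟨fun x => (f x).toNNReal, by fun_prop⟩, ?_⟩, fun x hx => ?_, fun x hx => ?_,
    fun x => ?_⟩
  · exact HasCompactSupport.comp_left (g := Real.toNNReal) h2 Real.toNNReal_zero
  · simp [h1 hx]
  · have : f x = 0 := image_eq_zero_of_notMem_tsupport fun h => hx (h3 h)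
    simp [this]
  · simpa using (h4 x).2

variable [MeasurableSpace X]

/-- No mass escapes when all the measures are carried by the same compact set. -/
lemma vague_limit_univ_eq {μ : ℕ → Measure X} {𝒰 : Ultrafilter ℕ} {ν : Measure X}
    (hlim : ∀ f : C_c(X, ℝ≥0),
      Tendsto (fun n => ∫⁻ x, f x ∂(μ n)) 𝒰 (𝓝 (∫⁻ x, f x ∂ν)))
    {F : Set X} (hF : IsCompact F) (hμ : ∀ᶠ n in (𝒰 : Filter ℕ), μ n Fᶜ = 0) (hν : ν Fᶜ = 0) :
    Tendsto (fun n => μ n univ) 𝒰 (𝓝 (ν univ)) := by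
  obtain ⟨f, h1, -, -⟩ := exists_compactlySupported_one hF isOpen_univ (subset_univ F)
  have key : ∀ ρ : Measure X, ρ Fᶜ = 0 → ∫⁻ x, f x ∂ρ = ρ univ := fun ρ hρ => by
    rw [← lintegral_one]
    refine lintegral_congr_ae ?_
    filter_upwards [measure_eq_zero_iff_ae_notMem.1 hρ] with x hx
    simp [h1 x (not_not.1 hx)]
  rw [← key ν hν]
  refine (hlim f).congr' ?_
  filter_upwards [hμ] with n hn using key _ hn

variable [BorelSpace X]

/-- Vague compactness for sequences of measures, in the form of convergence along an
ultrafilter: the limit of the integrals is a positive linear functional, which the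
Riesz-Markov-Kakutani theorem represents. -/
theorem exists_vague_limit (μ : ℕ → Measure X)
    (h : ∀ f : C_c(X, ℝ≥0), ∃ B : ℝ≥0∞, B ≠ ⊤ ∧ ∀ n, ∫⁻ x, f x ∂(μ n) ≤ B) :
    ∃ (𝒰 : Ultrafilter ℕ) (ν : Measure X), (𝒰 : Filter ℕ) ≤ atTop ∧ ν.Regular ∧
      ∀ f : C_c(X, ℝ≥0), Tendsto (fun n => ∫⁻ x, f x ∂(μ n)) 𝒰 (𝓝 (∫⁻ x, f x ∂ν)) := by
  set 𝒰 : Ultrafilter ℕ := Ultrafilter.of atTop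
  have h𝒰 : (𝒰 : Filter ℕ) ≤ atTop := Ultrafilter.of_le _
  have hlim : ∀ f : C_c(X, ℝ≥0), ∃ l : ℝ≥0,
      Tendsto (fun n => ∫⁻ x, f x ∂(μ n)) 𝒰 (𝓝 (l : ℝ≥0∞)) := by
    intro f
    obtain ⟨B, hB, hle⟩ := h f
    obtain ⟨l, hl, hl2⟩ := (isCompact_Icc (a := 0) (b := B)).ultrafilter_le_nhds
      (𝒰.map fun n => ∫⁻ x, f x ∂(μ n)) (by
        rw [le_principal_iff, Ultrafilter.mem_coe, Ultrafilter.mem_map]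
        exact Filter.univ_mem' fun n => ⟨zero_le, hle n⟩)
    have hl3 : l ≠ ⊤ := ne_top_of_le_ne_top hB hl.2
    exact ⟨l.toNNReal, by rw [ENNReal.coe_toNNReal hl3]; exact hl2⟩
  choose L hL using hlim
  have meas : ∀ f : C_c(X, ℝ≥0), Measurable fun x => (f x : ℝ≥0∞) := fun f =>
    f.continuous.measurable.coe_nnreal_ennreal
  let Λ : C_c(X, ℝ≥0) →ₗ[ℝ≥0] ℝ≥0 :=
    { toFun := L
      map_add' := fun f g => by
        have h1 := (hL f).add (hL g)
        have h2 := hL (f + g)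
        have : ∀ n, ∫⁻ x, (f + g) x ∂(μ n) = ∫⁻ x, f x ∂(μ n) + ∫⁻ x, g x ∂(μ n) := fun n => by
          rw [← lintegral_add_left (meas f)]
          simp
        simp only [this] at h2
        exact_mod_cast tendsto_nhds_unique h2 h1
      map_smul' := fun a f => by
        have h1 := ENNReal.Tendsto.const_mul (hL f) (.inr (ENNReal.coe_ne_top (r := a)))
        have h2 := hL (a • f)
        have : ∀ n, ∫⁻ x, (a • f) x ∂(μ n) = a * ∫⁻ x, f x ∂(μ n) := fun n => by
          rw [← lintegral_const_mul _ (meas f)]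
          simp
        simp only [this] at h2
        exact_mod_cast tendsto_nhds_unique h2 h1 }
  refine ⟨𝒰, NNRealRMK.rieszMeasure Λ, h𝒰, inferInstance, fun f => ?_⟩
  rw [NNRealRMK.lintegral_rieszMeasure]
  exact hL f

/-- A closed set that eventually carries the measures of the sequence carries a vague limit. -/
lemma vague_limit_compl_eq_zero {μ : ℕ → Measure X} {𝒰 : Ultrafilter ℕ} {ν : Measure X}
    [ν.Regular] (hlim : ∀ f : C_c(X, ℝ≥0),
      Tendsto (fun n => ∫⁻ x, f x ∂(μ n)) 𝒰 (𝓝 (∫⁻ x, f x ∂ν)))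
    {F : Set X} (hF : IsClosed F) (hμ : ∀ᶠ n in (𝒰 : Filter ℕ), μ n Fᶜ = 0) : ν Fᶜ = 0 := by
  rw [hF.isOpen_compl.measure_eq_iSup_isCompact ν]
  simp only [ENNReal.iSup_eq_zero]
  intro K hKF hK
  obtain ⟨f, h1, h0, -⟩ := exists_compactlySupported_one hK hF.isOpen_compl hKF
  have hz : ∫⁻ x, f x ∂ν = 0 := by
    refine tendsto_nhds_unique (hlim f) (tendsto_const_nhds.congr' ?_)
    filter_upwards [hμ] with n hn
    symm
    refine (lintegral_eq_zero_iff f.continuous.measurable.coe_nnreal_ennreal).2 ?_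
    refine measure_mono_null (fun x hx => ?_) hn
    by_contra hxF
    exact hx (by simpa using h0 x hxF)
  refine le_antisymm ?_ zero_le
  rw [← hz, ← lintegral_indicator_one hK.measurableSet]
  refine lintegral_mono (indicator_le' (fun x hx => ?_) (fun x _ => zero_le))
  simp [h1 x hx]

end VagueLimit

lemma isLocallyFiniteMeasure_coe_smul (a : ℝ≥0) {X : Type*} [TopologicalSpace X]
    [MeasurableSpace X] (μ : Measure X) [IsLocallyFiniteMeasure μ] :
    IsLocallyFiniteMeasure ((a : ℝ≥0∞) • μ) :=
  inferInstanceAs (IsLocallyFiniteMeasure (a • μ))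

namespace PotentialKernel

variable {X ι : Type*} [MetricSpace X] [MeasurableSpace X] [BorelSpace X]
  [Countable ι] (k : PotentialKernel X ι)

/-- The energy is lower semicontinuous. -/
lemma energy_le_of_tendsto {μ : ℕ → Measure X} {𝒰 : Ultrafilter ℕ} {ν : Measure X}
    (hlim : ∀ i, Tendsto (fun n => k.coeff (μ n) i) 𝒰 (𝓝 (k.coeff ν i))) {L : ℝ≥0∞}
    (hL : ∀ᶠ n in (𝒰 : Filter ℕ), k.energy (μ n) ≤ L) : k.energy ν ≤ L := by
  rw [energy_eq, ENNReal.tsum_eq_iSup_sum]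
  refine iSup_le fun s => ?_
  have : Tendsto (fun n => ∑ i ∈ s, k.weight i * k.coeff (μ n) i ^ k.p) 𝒰
      (𝓝 (∑ i ∈ s, k.weight i * k.coeff ν i ^ k.p)) :=
    tendsto_finsetSum _ fun i _ => ENNReal.Tendsto.const_mul
      (((ENNReal.continuous_rpow_const).tendsto _).comp (hlim i)) (.inr ENNReal.coe_ne_top)
  refine le_of_tendsto this ?_
  filter_upwards [hL] with n hn
  refine le_trans ?_ hn
  rw [energy_eq]
  exact ENNReal.sum_le_tsum s

/-- The defining inequality of `massBound`, made homogeneous: scaling a measure by `a` multiplies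
its energy by `a ^ p`. Finiteness of both factors excludes a product `0 * ⊤` on the right. -/
lemma univ_le_massBound_mul {K : Set X} (hK : k.massBound K ≠ ⊤) (μ : Measure X)
    [IsLocallyFiniteMeasure μ] (h : μ Kᶜ = 0) (he : k.energy μ ≠ ⊤) :
    μ univ ≤ k.massBound K * k.energy μ ^ (1 / k.p) := by
  have scale : ∀ a : ℝ≥0, (a : ℝ≥0∞) ^ k.p * k.energy μ ≤ 1 → a * μ univ ≤ k.massBound K := by
    intro a ha
    have := isLocallyFiniteMeasure_coe_smul a μ
    have := k.le_massBound (K := K) ((a : ℝ≥0∞) • μ) (by simp [h]) (by rwa [energy_smul])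
    simpa using this
  rcases eq_or_ne (k.energy μ) 0 with h0 | h0
  · suffices μ univ = 0 by simp [this]
    -- Every multiple of a measure of energy zero is admissible.
    by_contra hne
    have h1 : ∀ n : ℕ, (n : ℝ≥0∞) * μ univ ≤ k.massBound K := fun n => by
      simpa using scale n (by simp [h0])
    obtain ⟨n, hn⟩ := ENNReal.exists_nat_mul_gt hne hK
    exact absurd (h1 n) (not_le.2 hn)
  · obtain ⟨e, he'⟩ : ∃ e : ℝ≥0, (e : ℝ≥0∞) = k.energy μ := ⟨_, ENNReal.coe_toNNReal he⟩
    have he0 : e ≠ 0 := by rintro rfl; exact h0 he'.symm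
    have h1 := scale (e ^ (-(1 / k.p))) (by
      rw [← he', ← ENNReal.coe_rpow_of_ne_zero (by positivity), ← NNReal.rpow_mul,
        neg_mul, one_div_mul_cancel k.p_pos.ne', ← ENNReal.coe_mul, NNReal.rpow_neg_one,
        inv_mul_cancel₀ he0, ENNReal.coe_one])
    rw [← he', ← ENNReal.coe_rpow_of_ne_zero he0]
    calc μ univ = (e ^ (-(1 / k.p)) : ℝ≥0) * μ univ * (e ^ (1 / k.p) : ℝ≥0) := by
          rw [mul_right_comm, ← ENNReal.coe_mul, ← NNReal.rpow_add he0]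
          simp
      _ ≤ _ := by gcongr

/-- A measure whose energy does not exceed its mass `m` has mass at most the capacity: test the
capacity with `m ^ (-1/p) • μ`. -/
lemma univ_le_capCompact {K : Set X} (μ : Measure X) [IsLocallyFiniteMeasure μ]
    (h : μ Kᶜ = 0) (hμ : μ univ ≠ ⊤) (he : k.energy μ ≤ μ univ) : μ univ ≤ k.capCompact K := by
  obtain ⟨m, hm⟩ : ∃ m : ℝ≥0, (m : ℝ≥0∞) = μ univ := ⟨_, ENNReal.coe_toNNReal hμ⟩
  rcases eq_or_ne m 0 with rfl | h0
  · simp [← hm]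
  have h1 : ((m ^ (-(1 / k.p)) : ℝ≥0) : ℝ≥0∞) * μ univ ≤ k.massBound K := by
    have := isLocallyFiniteMeasure_coe_smul (m ^ (-(1 / k.p))) μ
    have := k.le_massBound (K := K) (((m ^ (-(1 / k.p)) : ℝ≥0) : ℝ≥0∞) • μ) (by simp [h]) (by
      rw [energy_smul, ← ENNReal.coe_rpow_of_ne_zero (by positivity), ← NNReal.rpow_mul,
        neg_mul, one_div_mul_cancel k.p_pos.ne', NNReal.rpow_neg_one]
      calc _ ≤ ((m⁻¹ : ℝ≥0) : ℝ≥0∞) * μ univ := by gcongr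
        _ = 1 := by rw [← hm, ← ENNReal.coe_mul, inv_mul_cancel₀ h0, ENNReal.coe_one])
    simpa using this
  rw [← hm, ← ENNReal.coe_mul] at h1
  have h2 : m ^ (-(1 / k.p)) * m = m ^ (1 / k.q) := by
    conv_lhs => rw [← NNReal.rpow_one m, ← NNReal.rpow_mul, one_mul, ← NNReal.rpow_add h0]
    congr 1
    have := k.inv_p_add_inv_q
    simp only [one_div]; linarith
  rw [h2] at h1
  have h3 := ENNReal.rpow_le_rpow h1 k.q_pos.le
  rw [← ENNReal.coe_rpow_of_ne_zero (by positivity), ← NNReal.rpow_mul,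
    one_div_mul_cancel k.q_pos.ne', NNReal.rpow_one, hm] at h3
  exact h3

end PotentialKernel
end

/-! ### Compact sets: finiteness of the capacity and existence of a maximizer -/

section

open Filter Topology
open scoped NNReal CompactlySupported

/-- A convex function lies above its tangent, here the one at `x + y`. -/
lemma NNReal.add_rpow_le_tangent {p : ℝ} (hp : 1 ≤ p) (x y : ℝ≥0) :
    (x + y) ^ p ≤ x ^ p + p.toNNReal * y * (x + y) ^ (p - 1) := by
  rcases eq_or_ne (x + y) 0 with h | h
  · rw [h, NNReal.zero_rpow (by linarith)]; exact zero_le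
  have hpos : (0 : ℝ) < x + y := by exact_mod_cast pos_iff_ne_zero.2 h
  rw [← NNReal.coe_le_coe]
  push_cast
  rw [Real.coe_toNNReal p (by linarith)]
  have h1 := one_add_mul_self_le_rpow_one_add (s := -(y / (x + y) : ℝ))
    (by rw [neg_le_neg_iff, div_le_one hpos]; linarith [x.coe_nonneg]) hp
  have h2 : 1 + -((y : ℝ) / (x + y)) = x / (x + y) := by field_simp; ring
  rw [h2, Real.div_rpow x.coe_nonneg hpos.le, le_div_iff₀ (by positivity)] at h1
  have h3 : ((x : ℝ) + y) ^ p = (x + y) * (x + y) ^ (p - 1) := by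
    conv_rhs => rw [← Real.rpow_one_add' hpos.le (by linarith)]
    congr 1; ring
  have h4 : (1 + p * -((y : ℝ) / (x + y))) * (x + y) ^ p =
      (x + y) ^ p - p * y * (x + y) ^ (p - 1) := by
    rw [h3]; field_simp; ring
  linarith

namespace PotentialKernel

variable {X ι : Type*} [MetricSpace X] [MeasurableSpace X] [BorelSpace X]
  (k : PotentialKernel X ι)

/-- The points seen by no function of the kernel. A compact set has infinite capacity exactly
when it contains such a point. -/
def blind (k : PotentialKernel X ι) : Set X := {z | ∀ i, k.fn i z = 0}

lemma coeff_dirac (z : X) (i : ι) : k.coeff (Measure.dirac z) i = k.fn i z :=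
  lintegral_dirac' _ (k.measurable_fn i)

lemma wolff_smul_dirac_of_mem_blind {z : X} (hz : z ∈ k.blind) (a : ℝ≥0∞) (y : X) :
    k.wolff (a • Measure.dirac z) y = 0 := by
  rw [wolff_smul]
  simp [wolff, pot, coeff_dirac, hz _, k.p_sub_one_pos]

variable [Countable ι]

lemma energy_dirac_of_mem_blind {z : X} (hz : z ∈ k.blind) : k.energy (Measure.dirac z) = 0 := by
  simp [energy_eq, coeff_dirac, hz _, k.p_pos]

lemma massBound_eq_top_of_mem_blind {K : Set X} {z : X} (hzK : z ∈ K) (hz : z ∈ k.blind) :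
    k.massBound K = ⊤ := by
  by_contra hne
  have := k.univ_le_massBound_mul hne (Measure.dirac z)
    (by simp [hzK]) (by simp [k.energy_dirac_of_mem_blind hz])
  simp [k.energy_dirac_of_mem_blind hz, k.p_pos] at this

/-- Away from the blind points a bound on the energy is a local bound on the mass. -/
lemma exists_nhds_measure_le {z : X} (hz : z ∉ k.blind) :
    ∃ V ∈ 𝓝 z, ∃ B : ℝ≥0∞, B ≠ ⊤ ∧ ∀ μ : Measure X, μ V ≤ B * k.energy μ ^ (1 / k.p) := by
  obtain ⟨i, hi⟩ : ∃ i, k.fn i z ≠ 0 := by simpa [blind] using hz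
  set δ : ℝ≥0 := k.fn i z / 2
  have hδ : 0 < δ := by positivity
  have hw := k.weight_pos i
  refine ⟨{y | δ < k.fn i y}, ?_, (δ⁻¹ * (k.weight i)⁻¹ ^ (1 / k.p) : ℝ≥0), ENNReal.coe_ne_top,
    fun μ => ?_⟩
  · exact (isOpen_lt continuous_const (k.fn i).continuous).mem_nhds
      (half_lt_self (pos_iff_ne_zero.2 hi))
  · have h1 : (δ : ℝ≥0∞) * μ {y | δ < k.fn i y} ≤ k.coeff μ i := by
      refine le_trans ?_ (mul_meas_ge_le_lintegral (k.measurable_fn i) δ)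
      refine mul_le_mul_right (measure_mono fun y hy => ?_) _
      exact ENNReal.coe_le_coe.2 (le_of_lt (show δ < k.fn i y from hy))
    have h2 : (k.weight i : ℝ≥0∞) * k.coeff μ i ^ k.p ≤ k.energy μ := by
      rw [energy_eq]; exact ENNReal.le_tsum i
    have h3 : k.coeff μ i ≤ ((k.weight i)⁻¹ ^ (1 / k.p) : ℝ≥0) * k.energy μ ^ (1 / k.p) := by
      rw [ENNReal.coe_rpow_of_nonneg _ (by have := k.p_pos; positivity),
        ← ENNReal.mul_rpow_of_nonneg _ _ (by have := k.p_pos; positivity),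
        one_div, ENNReal.le_rpow_inv_iff k.p_pos, ENNReal.coe_inv hw.ne',
        ← ENNReal.div_eq_inv_mul, ENNReal.le_div_iff_mul_le (by simp [hw.ne']) (by simp), mul_comm]
      exact h2
    rw [ENNReal.coe_mul, mul_assoc, ENNReal.coe_inv hδ.ne', ← ENNReal.div_eq_inv_mul,
      ENNReal.le_div_iff_mul_le (by simp [hδ.ne']) (by simp), mul_comm]
    exact h1.trans h3

lemma exists_measure_le_of_isCompact {K : Set X} (hK : IsCompact K) (h : Disjoint K k.blind) :
    ∃ B : ℝ≥0∞, B ≠ ⊤ ∧ ∀ μ : Measure X, μ K ≤ B * k.energy μ ^ (1 / k.p) := by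
  refine hK.induction_on (p := fun K => ∃ B : ℝ≥0∞, B ≠ ⊤ ∧
    ∀ μ : Measure X, μ K ≤ B * k.energy μ ^ (1 / k.p)) ⟨0, by simp⟩ ?_ ?_ ?_
  · rintro s t hst ⟨B, hB, h⟩
    exact ⟨B, hB, fun μ => (measure_mono hst).trans (h μ)⟩
  · rintro s t ⟨B, hB, h⟩ ⟨B', hB', h'⟩
    refine ⟨B + B', by finiteness, fun μ => ?_⟩
    rw [add_mul]
    exact (measure_union_le s t).trans (add_le_add (h μ) (h' μ))
  · intro z hz
    obtain ⟨V, hV, B, hB, hle⟩ := k.exists_nhds_measure_le (disjoint_left.1 h hz)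
    exact ⟨V, mem_nhdsWithin_of_mem_nhds hV, B, hB, hle⟩

theorem massBound_eq_top_iff {K : Set X} (hK : IsCompact K) :
    k.massBound K = ⊤ ↔ (K ∩ k.blind).Nonempty := by
  refine ⟨fun h => ?_, fun ⟨z, hz, hzb⟩ => k.massBound_eq_top_of_mem_blind hz hzb⟩
  by_contra hne
  rw [← not_disjoint_iff_nonempty_inter, not_not] at hne
  obtain ⟨B, hB, hle⟩ := k.exists_measure_le_of_isCompact hK hne
  have : k.massBound K ≤ B := iSup₂_le fun μ hμ => by
    have h1 : μ univ = μ K := by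
      rw [← measure_add_measure_compl hK.measurableSet, hμ.1.2, add_zero]
    rw [h1]
    refine (hle μ).trans ?_
    calc B * k.energy μ ^ (1 / k.p) ≤ B * 1 ^ (1 / k.p) := by
          gcongr
          · have := k.p_pos; positivity
          · exact hμ.2
      _ = B := by simp
  exact hB (top_le_iff.1 (h ▸ this))

variable [ProperSpace X]

/-- Vague compactness for measures on a fixed compact set with bounded mass and energy. -/
lemma exists_limit_of_isCompact {μ : ℕ → Measure X} {F : Set X} (hF : IsCompact F)
    (hμF : ∀ n, μ n Fᶜ = 0) {M : ℝ≥0∞} (hM : M ≠ ⊤) (hμM : ∀ n, μ n univ ≤ M) {L : ℝ≥0∞}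
    (hL : ∀ n, k.energy (μ n) ≤ L) :
    ∃ (𝒰 : Ultrafilter ℕ) (ν : Measure X), (𝒰 : Filter ℕ) ≤ atTop ∧ IsFiniteMeasure ν ∧
      Tendsto (fun n => μ n univ) 𝒰 (𝓝 (ν univ)) ∧ k.energy ν ≤ L ∧
      ∀ G : Set X, IsClosed G → (∀ᶠ n in atTop, μ n Gᶜ = 0) → ν Gᶜ = 0 := by
  obtain ⟨𝒰, ν, h𝒰, hν, hlim⟩ := exists_vague_limit μ fun f => by
    obtain ⟨B, hB⟩ := f.continuous.bddAbove_range_of_hasCompactSupport f.hasCompactSupport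
    refine ⟨B * M, by finiteness, fun n => ?_⟩
    calc ∫⁻ x, f x ∂(μ n) ≤ ∫⁻ _, B ∂(μ n) :=
          lintegral_mono fun x => ENNReal.coe_le_coe.2 (hB (mem_range_self x))
      _ ≤ B * M := by rw [lintegral_const]; gcongr; exact hμM n
  have hcl : ∀ G : Set X, IsClosed G → (∀ᶠ n in atTop, μ n Gᶜ = 0) → ν Gᶜ = 0 :=
    fun G hG h => vague_limit_compl_eq_zero hlim hG (h𝒰 h)
  have hu := vague_limit_univ_eq hlim hF (Eventually.of_forall hμF)
    (hcl F hF.isClosed (Eventually.of_forall hμF))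
  refine ⟨𝒰, ν, h𝒰, ⟨?_⟩, hu, k.energy_le_of_tendsto (fun i => hlim (k.fn i))
    (Eventually.of_forall hL), hcl⟩
  exact (le_of_tendsto hu (Eventually.of_forall hμM)).trans_lt hM.lt_top

lemma exists_maximizer {K : Set X} (hK : IsCompact K) (hM : k.massBound K ≠ ⊤) :
    ∃ μ : Measure X, IsFiniteMeasure μ ∧ μ Kᶜ = 0 ∧ μ univ = k.massBound K ∧ k.energy μ ≤ 1 := by
  rcases eq_or_ne (k.massBound K) 0 with h0 | h0
  · refine ⟨0, inferInstance, by simp, by simp [h0], ?_⟩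
    rw [energy, lintegral_zero_measure]; exact zero_le
  obtain ⟨u, -, hu, hulim⟩ := exists_seq_strictMono_tendsto' (pos_iff_ne_zero.2 h0)
  have : ∀ n, ∃ μ : Measure X, (IsLocallyFiniteMeasure μ ∧ μ Kᶜ = 0) ∧ k.energy μ ≤ 1 ∧
      u n < μ univ := fun n => by
    obtain ⟨μ, hμ⟩ := lt_iSup_iff.1 (hu n).2
    obtain ⟨h1, h2⟩ := lt_iSup_iff.1 hμ
    exact ⟨μ, h1.1, h1.2, h2⟩
  choose μ hμ hE hlt using this
  have hle : ∀ n, μ n univ ≤ k.massBound K := fun n =>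
    have := (hμ n).1
    k.le_massBound _ (hμ n).2 (hE n)
  obtain ⟨𝒰, ν, h𝒰, hν, hlim, hEν, hcl⟩ :=
    k.exists_limit_of_isCompact hK (fun n => (hμ n).2) hM hle hE
  refine ⟨ν, hν, hcl K hK.isClosed (Eventually.of_forall fun n => (hμ n).2), ?_, hEν⟩
  exact tendsto_nhds_unique hlim (tendsto_of_tendsto_of_tendsto_of_le_of_le (hulim.mono_left h𝒰)
    tendsto_const_nhds (fun n => (hlt n).le) hle)

end PotentialKernel
end

/-! ### The variational inequality and extremal measures -/

section

open Filter Topology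
open scoped NNReal CompactlySupported

namespace PotentialKernel

variable {X ι : Type*} [MetricSpace X] [MeasurableSpace X] [BorelSpace X]
  [Countable ι] (k : PotentialKernel X ι)

lemma energy_add_ne_top {μ ν : Measure X} (hμ : k.energy μ ≠ ⊤) (hν : k.energy ν ≠ ⊤) :
    k.energy (μ + ν) ≠ ⊤ := by
  refine ne_top_of_le_ne_top (b := 2 ^ (k.p - 1) * (k.energy μ + k.energy ν))
    (ENNReal.mul_ne_top (ENNReal.rpow_ne_top_of_nonneg k.p_sub_one_pos.le ENNReal.ofNat_ne_top)
      (by finiteness)) ?_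
  simp only [energy_eq, ← ENNReal.tsum_add, ← ENNReal.tsum_mul_left]
  refine ENNReal.tsum_le_tsum fun i => ?_
  rw [coeff_add]
  calc k.weight i * (k.coeff μ i + k.coeff ν i) ^ k.p
      ≤ k.weight i * (2 ^ (k.p - 1) * (k.coeff μ i ^ k.p + k.coeff ν i ^ k.p)) := by
        gcongr
        exact ENNReal.rpow_add_le_mul_rpow_add_rpow _ _ k.one_lt_p.le
    _ = _ := by ring

lemma energy_add_le (μ ν : Measure X) [IsFiniteMeasureOnCompacts μ]
    [IsFiniteMeasureOnCompacts ν] :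
    k.energy (μ + ν) ≤ k.energy μ +
      k.p.toNNReal * ∫⁻ z, k.wolff (μ + ν) z ∂ν := by
  simp only [wolff, lintegral_pot]
  simp only [energy_eq, ← ENNReal.tsum_mul_left, ← ENNReal.tsum_add]
  refine ENNReal.tsum_le_tsum fun i => ?_
  obtain ⟨a, ha⟩ : ∃ a : ℝ≥0, (a : ℝ≥0∞) = k.coeff μ i :=
    ⟨_, ENNReal.coe_toNNReal (k.coeff_ne_top μ i)⟩
  obtain ⟨b, hb⟩ : ∃ a : ℝ≥0, (a : ℝ≥0∞) = k.coeff ν i :=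
    ⟨_, ENNReal.coe_toNNReal (k.coeff_ne_top ν i)⟩
  rw [coeff_add, ← ha, ← hb, ← ENNReal.coe_add, ← ENNReal.coe_rpow_of_nonneg _ k.p_pos.le,
    ← ENNReal.coe_rpow_of_nonneg _ k.p_pos.le, ← ENNReal.coe_rpow_of_nonneg _ k.p_sub_one_pos.le]
  norm_cast
  calc k.weight i * (a + b) ^ k.p
      ≤ k.weight i * (a ^ k.p + k.p.toNNReal * b * (a + b) ^ (k.p - 1)) := by
        gcongr; exact NNReal.add_rpow_le_tangent k.one_lt_p.le a b
    _ = _ := by ring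

lemma lintegral_wolff_ne_top {μ ν : Measure X} (hμ : k.energy μ ≠ ⊤) (hν : k.energy ν ≠ ⊤) :
    ∫⁻ z, k.wolff μ z ∂ν ≠ ⊤ := by
  refine ne_top_of_le_ne_top ?_ (k.lintegral_pot_le _ ν)
  rw [modular_wolff]
  have := k.p_pos
  have := k.q_pos
  exact ENNReal.mul_ne_top (ENNReal.rpow_ne_top_of_nonneg (by positivity) hμ)
    (ENNReal.rpow_ne_top_of_nonneg (by positivity) hν)

lemma tendsto_lintegral_wolff_add_smul {μ ν : Measure X} (hμ : k.energy μ ≠ ⊤)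
    (hν : k.energy ν ≠ ⊤) (hνc : ∀ i, k.coeff ν i ≠ ⊤) :
    Tendsto (fun n : ℕ => ∫⁻ z, k.wolff (μ + (((n : ℝ≥0) + 1)⁻¹ : ℝ≥0) • ν) z ∂ν) atTop
      (𝓝 (∫⁻ z, k.wolff μ z ∂ν)) := by
  have hfin := k.lintegral_wolff_ne_top (k.energy_add_ne_top hμ hν) hν
  simp only [wolff, lintegral_pot] at hfin ⊢
  let _ : MeasurableSpace ι := ⊤
  simp only [← lintegral_count] at hfin ⊢
  refine tendsto_lintegral_of_dominated_convergence
    (fun i => k.weight i * k.coeff (μ + ν) i ^ (k.p - 1) * k.coeff ν i)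
    (fun n => measurable_from_top) (fun n => Eventually.of_forall fun i => ?_) hfin
    (Eventually.of_forall fun i => ?_)
  · dsimp only
    gcongr
    · exact k.p_sub_one_pos.le
    · refine k.coeff_mono (add_le_add le_rfl ?_) i
      intro s
      have : (((n : ℝ≥0) + 1)⁻¹ : ℝ≥0) ≤ 1 := inv_le_one_of_one_le₀ (by simp)
      rw [Measure.smul_apply, ENNReal.smul_def, smul_eq_mul]
      exact mul_le_of_le_one_left' (by exact_mod_cast this)
  · refine ENNReal.Tendsto.mul_const (ENNReal.Tendsto.const_mul
      ((ENNReal.continuous_rpow_const.tendsto _).comp ?_) (.inr ENNReal.coe_ne_top))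
      (.inr (hνc i))
    have h1 : ∀ n : ℕ, k.coeff (μ + (((n : ℝ≥0) + 1)⁻¹ : ℝ≥0) • ν) i =
        k.coeff μ i + (((n : ℝ≥0) + 1)⁻¹ : ℝ≥0) * k.coeff ν i := fun n => by
      rw [coeff_add]
      congr 1
      exact k.coeff_smul _ ν i
    simp only [h1]
    have h2 : Tendsto (fun n : ℕ => ((((n : ℝ≥0) + 1)⁻¹ : ℝ≥0) : ℝ≥0∞)) atTop
        (𝓝 ((0 : ℝ≥0) : ℝ≥0∞)) := by
      rw [ENNReal.tendsto_coe]
      simpa using tendsto_one_div_add_atTop_nhds_zero_nat (𝕜 := ℝ≥0)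
    have h3 := (ENNReal.Tendsto.mul_const h2 (b := k.coeff ν i) (.inr (hνc i))).const_add
      (k.coeff μ i)
    simpa using h3

/-- The Euler-Lagrange inequality for the measures of maximal mass and energy at most one,
obtained by comparing `μ` with `μ + t • ν` as `t → 0`. -/
theorem univ_le_of_maximizer {K : Set X} (hM : k.massBound K ≠ ⊤) {μ : Measure X}
    [IsFiniteMeasure μ] (hμK : μ Kᶜ = 0) (hμM : μ univ = k.massBound K) (hμE : k.energy μ ≤ 1)
    (ν : Measure X) [IsLocallyFiniteMeasure ν] (hνK : ν Kᶜ = 0) (hν : k.energy ν ≠ ⊤) :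
    ν univ ≤ k.massBound K * ∫⁻ z, k.wolff μ z ∂ν := by
  have hμE' : k.energy μ ≠ ⊤ := ne_top_of_le_ne_top ENNReal.one_ne_top hμE
  have hνfin : ν univ ≠ ⊤ := ne_top_of_le_ne_top (ENNReal.mul_ne_top hM
    (ENNReal.rpow_ne_top_of_nonneg (by have := k.p_pos; positivity) hν))
    (k.univ_le_massBound_mul hM ν hνK hν)
  have : IsFiniteMeasure ν := ⟨hνfin.lt_top⟩
  have key : ∀ t : ℝ≥0, t ≠ 0 → ν univ ≤ k.massBound K * ∫⁻ z, k.wolff (μ + t • ν) z ∂ν := by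
    intro t ht
    have htE : k.energy (t • ν) ≠ ⊤ := by
      have := k.energy_smul t ν
      rw [show (t • ν : Measure X) = (t : ℝ≥0∞) • ν from rfl, this]
      exact ENNReal.mul_ne_top (ENNReal.rpow_ne_top_of_nonneg k.p_pos.le ENNReal.coe_ne_top) hν
    have hE := k.energy_add_ne_top hμE' htE
    have hS : ∫⁻ z, k.wolff (μ + t • ν) z ∂ν ≠ ⊤ := k.lintegral_wolff_ne_top hE hν
    obtain ⟨S, hS'⟩ : ∃ S : ℝ≥0, (S : ℝ≥0∞) = ∫⁻ z, k.wolff (μ + t • ν) z ∂ν :=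
      ⟨_, ENNReal.coe_toNNReal hS⟩
    rw [← hS']
    have h1 := k.univ_le_massBound_mul hM (μ + t • ν) (by simp [hμK, hνK]) hE
    have h2 : k.energy (μ + t • ν) ≤ ((1 + t * S : ℝ≥0) : ℝ≥0∞) ^ k.p := by
      refine (k.energy_add_le μ (t • ν)).trans ?_
      rw [lintegral_smul_measure, ← hS', ← ENNReal.coe_rpow_of_nonneg _ k.p_pos.le]
      refine (add_le_add_left hμE _).trans ?_
      rw [ENNReal.smul_def, smul_eq_mul]
      norm_cast
      rw [← NNReal.coe_le_coe]
      push_cast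
      rw [Real.coe_toNNReal _ k.p_pos.le]
      exact one_add_mul_self_le_rpow_one_add (s := (t * S : ℝ))
        (by nlinarith [(t * S).coe_nonneg, NNReal.coe_mul t S])
        k.one_lt_p.le
    have h3 : k.energy (μ + t • ν) ^ (1 / k.p) ≤ ((1 + t * S : ℝ≥0) : ℝ≥0∞) := by
      rw [one_div, ENNReal.rpow_inv_le_iff k.p_pos]
      exact h2
    have h4 := h1.trans (mul_le_mul_right h3 _)
    have h5 : (μ + t • ν) univ = k.massBound K + t * ν univ := by
      rw [Measure.add_apply, hμM]; rfl
    rw [h5, ENNReal.coe_add, ENNReal.coe_one, mul_add, mul_one, ENNReal.add_le_add_iff_left hM,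
      ENNReal.coe_mul, mul_left_comm] at h4
    exact (ENNReal.mul_le_mul_iff_right (by simpa using ht) ENNReal.coe_ne_top).1 h4
  have hlim := ENNReal.Tendsto.const_mul
    (k.tendsto_lintegral_wolff_add_smul hμE' hν (k.coeff_ne_top ν)) (.inr hM)
  exact ge_of_tendsto' hlim fun n => key _ (by positivity)

variable [ProperSpace X]

/-- The extremal measure of a compact set of finite capacity. Its last property is a lower bound for
the potential in the mean against the measures of finite energy on `K`. -/
theorem exists_extremal {K : Set X} (hK : IsCompact K) (hC : k.capCompact K ≠ ⊤) :
    ∃ μ : Measure X, IsFiniteMeasure μ ∧ μ Kᶜ = 0 ∧ μ univ = k.capCompact K ∧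
      k.energy μ ≤ k.capCompact K ∧ (∀ z ∈ μ.support, k.wolff μ z ≤ 1) ∧
      ∀ ν : Measure X, IsLocallyFiniteMeasure ν → ν Kᶜ = 0 → k.energy ν ≠ ⊤ →
        ν univ ≤ ∫⁻ z, k.wolff μ z ∂ν := by
  have hM : k.massBound K ≠ ⊤ := fun h => hC (k.capCompact_eq_top_iff.2 h)
  obtain ⟨M, hM'⟩ : ∃ M : ℝ≥0, (M : ℝ≥0∞) = k.massBound K := ⟨_, ENNReal.coe_toNNReal hM⟩
  obtain ⟨μ₀, hfin, hμK, hμM, hμE⟩ := k.exists_maximizer hK hM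
  have hq := sub_pos.2 k.one_lt
  -- The factor `a` is chosen such that `a ^ (p - 1) = M`, which turns the lower bound `1 / M` for
  -- the potential of the maximizer into `1`.
  set a : ℝ≥0 := M ^ (k.q - 1)
  set μ : Measure X := (a : ℝ≥0∞) • μ₀
  have hμfin : IsFiniteMeasure μ := inferInstanceAs (IsFiniteMeasure (a • μ₀))
  have hcap : k.capCompact K = (M ^ k.q : ℝ≥0) := by
    rw [capCompact, ← hM', ENNReal.coe_rpow_of_nonneg _ k.q_pos.le]
  have hμuniv : μ univ = k.capCompact K := by
    rw [Measure.smul_apply, hμM, ← hM', hcap, smul_eq_mul, ← ENNReal.coe_mul]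
    congr 1
    rcases eq_or_ne M 0 with rfl | h0
    · simp [k.q_pos.ne']
    · rw [← NNReal.rpow_add_one h0]; simp
  have hwolff : ∀ z, k.wolff μ z = k.massBound K * k.wolff μ₀ z := fun z => by
    rw [wolff_smul, ← ENNReal.coe_rpow_of_nonneg _ k.p_sub_one_pos.le, ← NNReal.rpow_mul,
      mul_comm (k.q - 1), k.p_sub_one_mul_q_sub_one, NNReal.rpow_one, hM']
  have henergy : k.energy μ ≤ k.capCompact K := by
    rw [energy_smul, ← ENNReal.coe_rpow_of_nonneg _ k.p_pos.le, ← NNReal.rpow_mul,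
      k.q_sub_one_mul_p, ← hcap]
    exact mul_le_of_le_one_right' hμE
  have hvar : ∀ ν : Measure X, IsLocallyFiniteMeasure ν → ν Kᶜ = 0 → k.energy ν ≠ ⊤ →
      ν univ ≤ ∫⁻ z, k.wolff μ z ∂ν := fun ν _ hνK hν => by
    simp only [hwolff]
    rw [lintegral_const_mul' _ _ hM]
    exact k.univ_le_of_maximizer hM hμK hμM hμE ν hνK hν
  have hμK' : μ Kᶜ = 0 := by simp [μ, hμK]
  have henergy' : k.energy μ ≠ ⊤ := ne_top_of_le_ne_top hC henergy
  -- The variational inequality for the restrictions of `μ` gives `W μ ≥ 1` almost everywhere; the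
  -- energy is too small for strict inequality, and semicontinuity extends `W μ ≤ 1` to the support.
  have hge : (fun _ => 1) ≤ᵐ[μ] k.wolff μ := by
    refine ae_le_of_forall_setLIntegral_le_of_sigmaFinite measurable_const fun s hs _ => ?_
    rw [setLIntegral_one, ← Measure.restrict_apply_univ]
    exact hvar _ inferInstance (Measure.absolutelyContinuous_of_le Measure.restrict_le_self hμK')
      (ne_top_of_le_ne_top henergy' (k.energy_mono Measure.restrict_le_self))
  have heq : (fun _ => 1) =ᵐ[μ] k.wolff μ := by
    refine ae_eq_of_ae_le_of_lintegral_le hge (by simp) (k.measurable_pot _).aemeasurable ?_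
    rw [lintegral_one, hμuniv]
    exact henergy
  refine ⟨μ, hμfin, hμK', hμuniv, henergy, fun z hz => ?_, hvar⟩
  by_contra! hlt
  refine Measure.notMem_support_iff_exists.2 ⟨{y | 1 < k.wolff μ y},
    ((k.lowerSemicontinuous_wolff μ).isOpen_preimage 1).mem_nhds hlt, ?_⟩ hz
  refine measure_mono_null (fun y hy => ?_) (ae_iff.1 heq)
  exact ne_of_lt hy

end PotentialKernel
end

/-! ### Weak-type inequality, outer regularity and subadditivity -/

section

open Filter Topology
open scoped NNReal CompactlySupported

namespace PotentialKernel

variable {X ι : Type*} [MetricSpace X] [MeasurableSpace X] [BorelSpace X]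
  [Countable ι] (k : PotentialKernel X ι)

lemma capCompact_le_of_pot_ge (f : ι → ℝ≥0∞) {θ : ℝ≥0∞} (h0 : θ ≠ 0) (hθ : θ ≠ ⊤) {K : Set X}
    (hK : ∀ z ∈ K, θ ≤ k.pot f z) : k.capCompact K ≤ θ⁻¹ ^ k.q * k.modular f := by
  have : k.massBound K ≤ θ⁻¹ * k.modular f ^ (1 / k.q) := by
    refine iSup₂_le fun μ hμ => ?_
    rw [← ENNReal.div_eq_inv_mul, ENNReal.le_div_iff_mul_le (.inl h0) (.inl hθ), mul_comm]
    calc θ * μ univ = ∫⁻ _, θ ∂μ := by simp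
      _ ≤ ∫⁻ z, k.pot f z ∂μ := by
        refine lintegral_mono_ae ?_
        filter_upwards [measure_eq_zero_iff_ae_notMem.1 hμ.1.2] with z hz
          using hK z (not_not.1 hz)
      _ ≤ k.modular f ^ (1 / k.q) * k.energy μ ^ (1 / k.p) := k.lintegral_pot_le f μ
      _ ≤ k.modular f ^ (1 / k.q) * 1 ^ (1 / k.p) := by
        gcongr
        · have := k.p_pos; positivity
        · exact hμ.2
      _ = _ := by simp
  calc k.capCompact K ≤ (θ⁻¹ * k.modular f ^ (1 / k.q)) ^ k.q :=
        ENNReal.rpow_le_rpow this k.q_pos.le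
    _ = _ := by
      rw [ENNReal.mul_rpow_of_nonneg _ _ k.q_pos.le, ← ENNReal.rpow_mul,
        one_div_mul_cancel k.q_pos.ne', ENNReal.rpow_one]

/-- The capacitary weak-type inequality. -/
theorem cap_superlevel_le (f : ι → ℝ≥0∞) {θ : ℝ≥0∞} (h0 : θ ≠ 0) (hθ : θ ≠ ⊤) :
    k.cap {z | θ < k.pot f z} ≤ θ⁻¹ ^ k.q * k.modular f := by
  rcases eq_or_ne (k.modular f) ⊤ with hf | hf
  · rw [hf, ENNReal.mul_top]
    · exact le_top
    · simp [k.q_pos, hθ, h0]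
  · have hop : IsOpen {z | θ < k.pot f z} :=
      (k.lowerSemicontinuous_pot f (k.ne_top_of_modular hf)).isOpen_preimage θ
    rw [k.cap_of_isOpen hop]
    exact iSup₂_le fun K hK => k.capCompact_le_of_pot_ge f h0 hθ fun z hz => (hK.2 hz).le

/-- A measure whose potential is at most one on its support is dominated by the capacity. -/
theorem measure_le_capCompact [SecondCountableTopology X] {μ : Measure X} [IsLocallyFiniteMeasure μ]
    (h : ∀ z ∈ μ.support, k.wolff μ z ≤ 1) {K : Set X} (hK : IsCompact K) :
    μ K ≤ k.capCompact K := by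
  have h1 : (μ.restrict K) univ = μ K := by simp
  have hle : μ.restrict K ≤ μ := Measure.restrict_le_self
  rw [← h1]
  refine k.univ_le_capCompact _ ?_ ?_ ?_
  · rw [Measure.restrict_apply hK.measurableSet.compl]; simp
  · rw [h1]; exact hK.measure_ne_top
  · calc k.energy (μ.restrict K) ≤ ∫⁻ _, 1 ∂(μ.restrict K) := by
          refine lintegral_mono_ae ?_
          filter_upwards [ae_mono hle (Measure.support_mem_ae (μ := μ))] with z hz
            using (k.wolff_mono hle z).trans (h z hz)
      _ = _ := lintegral_one

variable [ProperSpace X]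

/-- Outer regularity on compact sets: measures of mass `m` and energy at most one on shrinking
neighbourhoods of `K` have a vague limit with these properties on `K`. -/
theorem cap_of_isCompact {K : Set X} (hK : IsCompact K) : k.cap K = k.capCompact K := by
  refine le_antisymm ?_ ((k.capCompact_le_capInner hK Subset.rfl).trans (k.capInner_le_cap K))
  by_contra! hlt
  obtain ⟨r, hr1, hr2⟩ := exists_between hlt
  have hrtop : r ≠ ⊤ := ne_top_of_lt hr2
  set m : ℝ≥0∞ := r ^ (1 / k.q)
  have hm : m ≠ ⊤ := ENNReal.rpow_ne_top_of_nonneg (by have := k.q_pos; positivity) hrtop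
  set ε : ℕ → ℝ := fun n => 1 / ((n : ℝ) + 1)
  have hε : ∀ n, 0 < ε n := fun n => by positivity
  have hεanti : Antitone ε := fun a b hab => one_div_le_one_div_of_le (by positivity) (by simpa)
  have hex : ∀ n, ∃ μ : Measure X, μ (Metric.cthickening (ε n) K)ᶜ = 0 ∧
      μ univ = m ∧ k.energy μ ≤ 1 := by
    intro n
    have h1 : r < k.capInner (Metric.thickening (ε n) K) :=
      hr2.trans_le (iInf₂_le _ ⟨Metric.isOpen_thickening, Metric.self_subset_thickening (hε n) K⟩)
    obtain ⟨L, hL⟩ := lt_iSup_iff.1 h1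
    obtain ⟨⟨hLc, hLs⟩, hL⟩ := lt_iSup_iff.1 hL
    have h2 : m < k.massBound L := by
      rw [massBound_eq]
      exact ENNReal.rpow_lt_rpow hL (by have := k.q_pos; positivity)
    obtain ⟨μ, hμ⟩ := lt_iSup_iff.1 h2
    obtain ⟨⟨⟨hμl, hμL⟩, hμE⟩, hμ⟩ := lt_iSup_iff.1 hμ
    have hμfin : μ univ ≠ ⊤ := by
      rw [← measure_add_measure_compl hLc.measurableSet, hμL, add_zero]
      exact hLc.measure_ne_top
    have hμ0 : μ univ ≠ 0 := (zero_le.trans_lt hμ).ne'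
    refine ⟨(m / μ univ) • μ, ?_, ?_, ?_⟩
    · have : μ (Metric.cthickening (ε n) K)ᶜ = 0 := measure_mono_null (compl_subset_compl.2
        (hLs.trans (Metric.thickening_subset_cthickening _ _))) hμL
      simp [this]
    · rw [Measure.smul_apply, smul_eq_mul, ENNReal.div_mul_cancel hμ0 hμfin]
    · refine (k.energy_mono fun s => ?_).trans hμE
      rw [Measure.smul_apply, smul_eq_mul]
      exact mul_le_of_le_one_left' (ENNReal.div_le_of_le_mul (by simpa using hμ.le))
  choose μ hμK hμm hμE using hex
  obtain ⟨𝒰, ν, h𝒰, hν, hlim, hEν, hcl⟩ := k.exists_limit_of_isCompact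
    (hK.cthickening (r := ε 0))
    (fun n => measure_mono_null (compl_subset_compl.2
      (Metric.cthickening_mono (hεanti (Nat.zero_le n)) K)) (hμK n)) hm (fun n => (hμm n).le) hμE
  have hνm : ν univ = m := by
    simp only [hμm] at hlim
    exact tendsto_nhds_unique hlim tendsto_const_nhds
  have hνK : ν Kᶜ = 0 := by
    have : Kᶜ ⊆ ⋃ n, (Metric.cthickening (ε n) K)ᶜ := by
      rw [← compl_iInter, compl_subset_compl]
      intro z hz
      have hz' : ∀ n, Metric.infEDist z K ≤ ENNReal.ofReal (ε n) := fun n => by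
        have := mem_iInter.1 hz n
        rwa [Metric.mem_cthickening_iff] at this
      have hlim : Tendsto (fun n => ENNReal.ofReal (ε n)) atTop (𝓝 0) := by
        rw [← ENNReal.ofReal_zero]
        exact (ENNReal.continuous_ofReal.tendsto _).comp tendsto_one_div_add_atTop_nhds_zero_nat
      have : Metric.infEDist z K = 0 := le_antisymm (ge_of_tendsto' hlim hz') zero_le
      rw [← hK.isClosed.closure_eq]
      exact Metric.mem_closure_iff_infEDist_zero.2 this
    refine measure_mono_null this (measure_iUnion_null fun n =>
      hcl _ Metric.isClosed_cthickening ?_)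
    filter_upwards [eventually_ge_atTop n] with j hj
    exact measure_mono_null (compl_subset_compl.2 (Metric.cthickening_mono (hεanti hj) K)) (hμK j)
  have hfinal := k.le_massBound ν hνK hEν
  rw [hνm, massBound_eq, ENNReal.rpow_le_rpow_iff (by have := k.q_pos; positivity)] at hfinal
  exact absurd hr1 (not_lt.2 hfinal)

/-- Subadditivity on open sets: since the potential of the extremal measure `μ` of a compact set
is at most one on its support, `μ` is dominated by the capacity of each of the open sets. -/
lemma capInner_iUnion_le {β : Type*} [Countable β] {U : β → Set X} (hU : ∀ n, IsOpen (U n)) :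
    k.capInner (⋃ n, U n) ≤ ∑' n, k.capInner (U n) := by
  refine iSup₂_le fun K ⟨hK, hKU⟩ => ?_
  by_cases hC : k.capCompact K = ⊤
  · obtain ⟨z, hzK, hz⟩ := (k.massBound_eq_top_iff hK).1 (k.capCompact_eq_top_iff.1 hC)
    obtain ⟨n, hn⟩ := mem_iUnion.1 (hKU hzK)
    have h1 : k.capInner (U n) = ⊤ := by
      refine top_le_iff.1 (le_trans ?_ (k.capCompact_le_capInner isCompact_singleton
        (singleton_subset_iff.2 hn)))
      rw [k.capCompact_eq_top_iff.2 (k.massBound_eq_top_of_mem_blind (mem_singleton z) hz)]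
    exact le_top.trans (h1.symm.le.trans (ENNReal.le_tsum n))
  · obtain ⟨μ, hfin, hμK, hμ, -, hW, -⟩ := k.exists_extremal hK hC
    calc k.capCompact K = μ K := by
          rw [← hμ, ← measure_add_measure_compl hK.measurableSet, hμK, add_zero]
      _ ≤ ∑' n, μ (U n) := (measure_mono hKU).trans (measure_iUnion_le U)
      _ ≤ _ := by
        refine ENNReal.tsum_le_tsum fun n => ?_
        rw [(hU n).measure_eq_iSup_isCompact]
        exact iSup₂_le fun L hL => iSup_le fun hLc =>
          (k.measure_le_capCompact hW hLc).trans (k.capCompact_le_capInner hLc hL)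

theorem cap_iUnion_le {β : Type*} [Countable β] (E : β → Set X) :
    k.cap (⋃ n, E n) ≤ ∑' n, k.cap (E n) := by
  refine ENNReal.le_of_forall_pos_le_add fun ε hε hfin => ?_
  obtain ⟨δ, hδ, hδε⟩ := ENNReal.exists_pos_sum_of_countable (ι := β) (ε := ε)
    (by simpa using hε.ne')
  have hne : ∀ n, k.cap (E n) ≠ ⊤ := fun n => ne_top_of_le_ne_top hfin.ne (ENNReal.le_tsum n)
  have : ∀ n, ∃ U, IsOpen U ∧ E n ⊆ U ∧ k.capInner U < k.cap (E n) + δ n := fun n =>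
    k.exists_isOpen_capInner_lt (ENNReal.lt_add_right (hne n) (by simpa using (hδ n).ne'))
  choose U hUo hEU hU using this
  calc k.cap (⋃ n, E n) ≤ k.capInner (⋃ n, U n) :=
        iInf₂_le _ ⟨isOpen_iUnion hUo, iUnion_mono hEU⟩
    _ ≤ ∑' n, k.capInner (U n) := k.capInner_iUnion_le hUo
    _ ≤ ∑' n, (k.cap (E n) + δ n) := ENNReal.tsum_le_tsum fun n => (hU n).le
    _ ≤ _ := by rw [ENNReal.tsum_add]; gcongr

lemma cap_union_le (E F : Set X) : k.cap (E ∪ F) ≤ k.cap E + k.cap F := by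
  rw [union_eq_iUnion]
  refine (k.cap_iUnion_le _).trans ?_
  rw [tsum_bool, add_comm]
  rfl

lemma cap_iUnion_eq_zero {β : Type*} [Countable β] {E : β → Set X} (h : ∀ n, k.cap (E n) = 0) :
    k.cap (⋃ n, E n) = 0 :=
  le_antisymm ((k.cap_iUnion_le E).trans (by simp [h])) zero_le

/-- A lower bound for a potential in the mean against all measures of finite energy on `K` holds
quasi-everywhere: a compact set on which the potential stays below some `u < 1` carries no nonzero
measure of finite energy. -/
theorem cap_pot_lt_one_eq_zero {f : ι → ℝ≥0∞} (hf : ∀ i, f i ≠ ⊤) {K : Set X} (hK : IsCompact K)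
    (h : ∀ ν : Measure X, IsLocallyFiniteMeasure ν → ν Kᶜ = 0 → k.energy ν ≠ ⊤ →
      ν univ ≤ ∫⁻ z, k.pot f z ∂ν) :
    k.cap {z ∈ K | k.pot f z < 1} = 0 := by
  obtain ⟨u, -, hu, hulim⟩ := exists_seq_strictMono_tendsto' (zero_lt_one' ℝ≥0∞)
  have hcover : {z ∈ K | k.pot f z < 1} ⊆ ⋃ n, K ∩ {z | k.pot f z ≤ u n} := by
    rintro z ⟨hz, hlt⟩
    obtain ⟨n, hn⟩ := (hulim.eventually (lt_mem_nhds hlt)).exists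
    exact mem_iUnion.2 ⟨n, hz, hn.le⟩
  refine k.cap_eq_zero_of_subset hcover (k.cap_iUnion_eq_zero fun n => ?_)
  have hcpt : IsCompact (K ∩ {z | k.pot f z ≤ u n}) :=
    hK.inter_right ((k.lowerSemicontinuous_pot f hf).isClosed_preimage (u n))
  rw [k.cap_of_isCompact hcpt, capCompact, ENNReal.rpow_eq_zero_iff_of_pos k.q_pos, massBound]
  simp only [ENNReal.iSup_eq_zero]
  rintro ν ⟨⟨hνl, hν⟩, hνE⟩
  by_contra hne
  have hνfin : ν univ ≠ ⊤ := by
    rw [← measure_add_measure_compl hcpt.measurableSet, hν, add_zero]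
    exact hcpt.measure_ne_top
  have h1 := h ν hνl (measure_mono_null (compl_subset_compl.2 inter_subset_left) hν)
    (ne_top_of_le_ne_top ENNReal.one_ne_top hνE)
  have h2 : ∫⁻ z, k.pot f z ∂ν ≤ u n * ν univ := by
    rw [← lintegral_const]
    refine lintegral_mono_ae ?_
    filter_upwards [measure_eq_zero_iff_ae_notMem.1 hν] with z hz using (not_not.1 hz).2
  have h3 : u n * ν univ < 1 * ν univ := (ENNReal.mul_lt_mul_iff_left hne hνfin).2 (hu n).2
  rw [one_mul] at h3
  exact absurd (h1.trans h2) (not_le.2 h3)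

/-- A sequence whose potential is at least one quasi-everywhere on `E` is a test sequence for the
capacity of `E`. -/
theorem cap_le_modular {f : ι → ℝ≥0∞} {E : Set X} (h : k.cap {z ∈ E | k.pot f z < 1} = 0) :
    k.cap E ≤ k.modular f := by
  rcases eq_or_ne (k.modular f) ⊤ with hf | hf
  · rw [hf]; exact le_top
  obtain ⟨u, -, hu, hulim⟩ := exists_seq_strictMono_tendsto' (zero_lt_one' ℝ≥0∞)
  have key : ∀ n, k.cap E ≤ (u n)⁻¹ ^ k.q * k.modular f := fun n => by
    have hsub : E ⊆ {z ∈ E | k.pot f z < 1} ∪ {z | u n < k.pot f z} := fun z hz => by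
      rcases lt_or_ge (k.pot f z) 1 with h | h
      · exact .inl ⟨hz, h⟩
      · exact .inr ((hu n).2.trans_le h)
    refine (k.cap_mono hsub).trans ((k.cap_union_le _ _).trans ?_)
    rw [h, zero_add]
    exact k.cap_superlevel_le f (hu n).1.ne' (ne_top_of_lt (hu n).2)
  have hlim : Tendsto (fun n => (u n)⁻¹ ^ k.q * k.modular f) atTop
      (𝓝 ((1 : ℝ≥0∞)⁻¹ ^ k.q * k.modular f)) :=
    ENNReal.Tendsto.mul_const ((ENNReal.continuous_rpow_const.tendsto _).comp
      (tendsto_inv_iff.2 hulim)) (.inr hf)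
  simpa using ge_of_tendsto' hlim key

end PotentialKernel
end

/-! ### Extremal measures for open sets and the dual formulas -/

section

open Filter Topology
open scoped NNReal CompactlySupported

namespace PotentialKernel

variable {X ι : Type*} [MetricSpace X] [MeasurableSpace X] [BorelSpace X]
  [Countable ι] (k : PotentialKernel X ι)

/-- Lower bounds for the mixed energy pass to vague limits: the sequences
`(∫ φ_i dμ_n) ^ (p - 1)` are bounded in weighted `ℓ^q` and converge pointwise, hence weakly. -/
lemma le_lintegral_wolff_of_tendsto {μ : ℕ → Measure X} {𝒰 : Ultrafilter ℕ} {ρ ν : Measure X}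
    (hlim : ∀ i, Tendsto (fun n => k.coeff (μ n) i) 𝒰 (𝓝 (k.coeff ρ i))) {L : ℝ≥0∞} (hL : L ≠ ⊤)
    (hμL : ∀ n, k.energy (μ n) ≤ L) (hν : k.energy ν ≠ ⊤) (hνc : ∀ i, k.coeff ν i ≠ ⊤)
    {c : ℝ≥0∞} (hc : ∀ᶠ n in (𝒰 : Filter ℕ), c ≤ ∫⁻ z, k.wolff (μ n) z ∂ν) :
    c ≤ ∫⁻ z, k.wolff ρ z ∂ν := by
  have hp := k.p_pos
  have hq := k.q_pos
  rw [energy_eq] at hν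
  have htail : Tendsto (fun s : Finset ι => ∫⁻ z, k.wolff ρ z ∂ν + L ^ (1 / k.q) *
      (∑' i : {i // i ∉ s}, k.weight i * k.coeff ν i ^ k.p) ^ (1 / k.p)) atTop
      (𝓝 (∫⁻ z, k.wolff ρ z ∂ν + L ^ (1 / k.q) * 0 ^ (1 / k.p))) :=
    (ENNReal.Tendsto.const_mul ((ENNReal.continuous_rpow_const.tendsto _).comp
      (ENNReal.tendsto_tsum_compl_atTop_zero hν))
      (.inr (ENNReal.rpow_ne_top_of_nonneg (by positivity) hL))).const_add _
  rw [ENNReal.zero_rpow_of_pos (by positivity), mul_zero, add_zero] at htail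
  refine ge_of_tendsto' htail fun s => ?_
  have h1 : Tendsto (fun n => ∑ i ∈ s, k.weight i * k.coeff (μ n) i ^ (k.p - 1) * k.coeff ν i +
      L ^ (1 / k.q) * (∑' i : {i // i ∉ s}, k.weight i * k.coeff ν i ^ k.p) ^ (1 / k.p)) 𝒰
      (𝓝 (∑ i ∈ s, k.weight i * k.coeff ρ i ^ (k.p - 1) * k.coeff ν i +
      L ^ (1 / k.q) * (∑' i : {i // i ∉ s}, k.weight i * k.coeff ν i ^ k.p) ^ (1 / k.p))) := by
    refine (tendsto_finsetSum _ fun i _ => ?_).add_const _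
    exact ENNReal.Tendsto.mul_const (ENNReal.Tendsto.const_mul
      ((ENNReal.continuous_rpow_const.tendsto _).comp (hlim i)) (.inr ENNReal.coe_ne_top))
      (.inr (hνc i))
  refine (ge_of_tendsto h1 ?_).trans ?_
  · filter_upwards [hc] with n hn
    refine hn.trans ?_
    simp only [wolff, lintegral_pot]
    refine (k.tsum_mul_le_sum_add (s := s) _ _).trans ?_
    rw [modular_wolff]
    gcongr
    exact hμL n
  · gcongr
    simp only [wolff, lintegral_pot]
    exact ENNReal.sum_le_tsum s

/-- A set of finite capacity stays away from the blind points: the energy of the point mass at `y`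
is a finite sum of continuous functions of `y` near such a point `z`, and vanishes at `z`. -/
lemma eventually_notMem_of_mem_blind {U : Set X} (hU : k.capInner U ≠ ⊤) {z : X}
    (hz : z ∈ k.blind) : ∀ᶠ y in 𝓝 z, y ∉ U := by
  have hp := k.p_pos
  have hq := k.q_pos
  obtain ⟨V, hV, hfin⟩ := k.finite_near z hz
  set s := hfin.toFinset
  set M := k.capInner U ^ (1 / k.q)
  have hM : M ≠ ⊤ := ENNReal.rpow_ne_top_of_nonneg (by positivity) hU
  have hen : ∀ y ∈ V, k.energy (Measure.dirac y) =
      ∑ i ∈ s, k.weight i * (k.fn i y : ℝ≥0∞) ^ k.p := by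
    intro y hy
    rw [energy_eq, tsum_eq_sum (s := s)]
    · simp only [coeff_dirac]
    · intro i hi
      have : k.fn i y = 0 := by
        by_contra hne
        exact hi (hfin.mem_toFinset.2 ⟨y, hy, hne⟩)
      simp [coeff_dirac, this, hp]
  have hlim : Tendsto (fun y => M * (∑ i ∈ s, k.weight i * (k.fn i y : ℝ≥0∞) ^ k.p) ^ (1 / k.p))
      (𝓝 z) (𝓝 (M * (∑ i ∈ s, k.weight i * (k.fn i z : ℝ≥0∞) ^ k.p) ^ (1 / k.p))) := by
    refine ENNReal.Tendsto.const_mul ((ENNReal.continuous_rpow_const.tendsto _).comp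
      (tendsto_finsetSum _ fun i _ => ENNReal.Tendsto.const_mul
        ((ENNReal.continuous_rpow_const.tendsto _).comp ((k.continuous_fn i).tendsto z))
        (.inr ENNReal.coe_ne_top))) (.inr hM)
  have h0 : M * (∑ i ∈ s, k.weight i * (k.fn i z : ℝ≥0∞) ^ k.p) ^ (1 / k.p) = 0 := by
    simp [hz _, hp]
  rw [h0] at hlim
  filter_upwards [hlim.eventually (gt_mem_nhds one_pos), hV] with y hy hyV hyU
  have hyM : k.massBound {y} ≤ M := by
    rw [massBound_eq]
    exact ENNReal.rpow_le_rpow (k.capCompact_le_capInner isCompact_singleton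
      (singleton_subset_iff.2 hyU)) (by positivity)
  have h1 := k.univ_le_massBound_mul (ne_top_of_le_ne_top hM hyM) (Measure.dirac y) (by simp) (by
    rw [hen y hyV]
    exact ENNReal.sum_ne_top.2 fun i _ => ENNReal.mul_ne_top ENNReal.coe_ne_top
      (ENNReal.rpow_ne_top_of_nonneg hp.le ENNReal.coe_ne_top))
  rw [measure_univ, hen y hyV] at h1
  exact absurd (h1.trans (mul_le_mul_left hyM _)) (not_le.2 hy)

variable [ProperSpace X]

/-- The extremal measure of an open set of finite capacity, a vague limit of those of a compact
exhaustion. -/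
theorem exists_wolff_ge_one_of_isOpen {U : Set X} (hU : IsOpen U) (hC : k.capInner U ≠ ⊤) :
    ∃ μ : Measure X, IsLocallyFiniteMeasure μ ∧ k.energy μ ≤ k.capInner U ∧
      k.cap {z ∈ U | k.wolff μ z < 1} = 0 := by
  obtain ⟨F, hF, -, hFU, hFmono⟩ := hU.exists_iUnion_isClosed
  set K : ℕ → Set X := fun n => F n ∩ compactCovering X n
  have hK : ∀ n, IsCompact (K n) := fun n => (isCompact_compactCovering X n).inter_left (hF n)
  have hKmono : Monotone K := fun a b hab =>
    inter_subset_inter (hFmono hab) (compactCovering_subset X hab)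
  have hKU : ⋃ n, K n = U := by
    rw [iUnion_inter_of_monotone hFmono (fun a b hab => compactCovering_subset X hab), hFU,
      iUnion_compactCovering, inter_univ]
  have hKC : ∀ n, k.capCompact (K n) ≤ k.capInner U := fun n =>
    k.capCompact_le_capInner (hK n) (hKU ▸ subset_iUnion K n)
  choose μ hμf hμK hμm hμE hμS hμW using fun n =>
    k.exists_extremal (hK n) (ne_top_of_le_ne_top hC (hKC n))
  have hE : ∀ n, k.energy (μ n) ≤ k.capInner U := fun n => (hμE n).trans (hKC n)
  have hloc : ∀ S : Set X, IsCompact S → ∃ B : ℝ≥0∞, B ≠ ⊤ ∧ ∀ n, μ n S ≤ B := by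
    intro S hS
    refine hS.induction_on (p := fun S => ∃ B : ℝ≥0∞, B ≠ ⊤ ∧ ∀ n, μ n S ≤ B) ⟨0, by simp⟩ ?_ ?_ ?_
    · rintro s t hst ⟨B, hB, h⟩
      exact ⟨B, hB, fun n => (measure_mono hst).trans (h n)⟩
    · rintro s t ⟨B, hB, h⟩ ⟨B', hB', h'⟩
      exact ⟨B + B', by finiteness,
        fun n => (measure_union_le s t).trans (add_le_add (h n) (h' n))⟩
    · intro z _
      by_cases hz : z ∈ k.blind
      · refine ⟨Uᶜ, mem_nhdsWithin_of_mem_nhds (k.eventually_notMem_of_mem_blind hC hz), 0,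
          by simp, fun n => le_of_eq (measure_mono_null ?_ (hμK n))⟩
        exact compl_subset_compl.2 (hKU ▸ subset_iUnion K n)
      · obtain ⟨V, hV, B, hB, hle⟩ := k.exists_nhds_measure_le hz
        refine ⟨V, mem_nhdsWithin_of_mem_nhds hV, B * k.capInner U ^ (1 / k.p),
          ENNReal.mul_ne_top hB (ENNReal.rpow_ne_top_of_nonneg (by have := k.p_pos; positivity) hC),
          fun n => (hle _).trans ?_⟩
        gcongr
        · have := k.p_pos; positivity
        · exact hE n
  obtain ⟨𝒰, ν, h𝒰, hν, hlim⟩ := exists_vague_limit μ fun f => by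
    obtain ⟨C, hC⟩ := f.continuous.bddAbove_range_of_hasCompactSupport f.hasCompactSupport
    obtain ⟨B, hB, hle⟩ := hloc _ f.hasCompactSupport
    refine ⟨C * B, by finiteness, fun n => ?_⟩
    calc ∫⁻ x, f x ∂(μ n) ≤ ∫⁻ x, (tsupport f).indicator (fun _ => (C : ℝ≥0∞)) x ∂(μ n) := by
          refine lintegral_mono fun x => ?_
          by_cases hx : x ∈ tsupport f
          · rw [indicator_of_mem hx]
            exact ENNReal.coe_le_coe.2 (hC (mem_range_self x))
          · simp [image_eq_zero_of_notMem_tsupport hx]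
      _ = C * μ n (tsupport f) := lintegral_indicator_const (isClosed_tsupport f).measurableSet _
      _ ≤ C * B := by gcongr; exact hle n
  have hlim' : ∀ i, Tendsto (fun n => k.coeff (μ n) i) 𝒰 (𝓝 (k.coeff ν i)) :=
    fun i => hlim (k.fn i)
  refine ⟨ν, inferInstance, k.energy_le_of_tendsto hlim' (Eventually.of_forall hE), ?_⟩
  have hsub : {z ∈ U | k.wolff ν z < 1} = ⋃ m, {z ∈ K m | k.wolff ν z < 1} := by
    rw [← hKU]; ext z; simp
  rw [hsub]
  refine k.cap_iUnion_eq_zero fun m => k.cap_pot_lt_one_eq_zero (fun i =>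
    ENNReal.rpow_ne_top_of_nonneg k.p_sub_one_pos.le (k.coeff_ne_top ν i)) (hK m)
    fun ρ hρ hρK hρE => ?_
  refine k.le_lintegral_wolff_of_tendsto hlim' hC hE hρE (k.coeff_ne_top ρ) (h𝒰 ?_)
  filter_upwards [eventually_ge_atTop m] with n hn
  exact hμW n ρ hρ (measure_mono_null (compl_subset_compl.2 (hKmono hn)) hρK) hρE

/-- The least energy of a Radon measure with potential at least one quasi-everywhere on `E`. -/
noncomputable def infEnergy (E : Set X) : ℝ≥0∞ :=
  ⨅ μ ∈ {μ : Measure X | IsLocallyFiniteMeasure μ ∧ k.cap {z ∈ E | k.wolff μ z < 1} = 0},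
    k.energy μ

theorem cap_eq_infEnergy (E : Set X) : k.cap E = k.infEnergy E := by
  refine le_antisymm (le_iInf₂ fun μ hμ => ?_) (le_iInf₂ fun U (hU : IsOpen U ∧ E ⊆ U) => ?_)
  · rw [← modular_wolff]
    exact k.cap_le_modular hμ.2
  · by_cases hC : k.capInner U = ⊤
    · rw [hC]; exact le_top
    obtain ⟨μ, hμ, hE, hW⟩ := k.exists_wolff_ge_one_of_isOpen hU.1 hC
    exact iInf₂_le_of_le μ ⟨hμ, k.cap_eq_zero_of_subset
      (F := {z ∈ U | k.wolff μ z < 1}) (fun z hz => ⟨hU.2 hz.1, hz.2⟩) hW⟩ hE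

/-- The largest mass of a Radon measure carried by `E` with potential at most one on its support. -/
noncomputable def supMass (E : Set X) : ℝ≥0∞ :=
  ⨆ μ ∈ {μ : Measure X | (IsLocallyFiniteMeasure μ ∧ μ Eᶜ = 0) ∧
    ∀ z ∈ μ.support, k.wolff μ z ≤ 1}, μ E

theorem capInner_eq_supMass (E : Set X) : k.capInner E = k.supMass E := by
  refine le_antisymm (iSup₂_le fun K ⟨hK, hKE⟩ => ?_) (iSup₂_le fun μ ⟨⟨hμ, hμE⟩, hW⟩ => ?_)
  · by_cases hC : k.capCompact K = ⊤
    · -- All multiples of a point mass at a blind point are admissible.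
      obtain ⟨z, hzK, hz⟩ := (k.massBound_eq_top_iff hK).1 (k.capCompact_eq_top_iff.1 hC)
      refine le_top.trans (top_le_iff.2 (ENNReal.eq_top_of_forall_nnreal_le fun a => ?_))
      refine le_iSup₂_of_le ((a : ℝ≥0∞) • Measure.dirac z)
        ⟨⟨isLocallyFiniteMeasure_coe_smul a _, by simp [hKE hzK]⟩, fun y _ => ?_⟩
        (by simp [hKE hzK])
      rw [k.wolff_smul_dirac_of_mem_blind hz]
      exact zero_le
    · obtain ⟨μ, hfin, hμK, hμ, -, hW, -⟩ := k.exists_extremal hK hC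
      have hμE : μ Eᶜ = 0 := measure_mono_null (compl_subset_compl.2 hKE) hμK
      refine le_iSup₂_of_le μ ⟨⟨inferInstance, hμE⟩, hW⟩ ?_
      rw [← hμ]
      refine (measure_mono (union_compl_self E).symm.subset).trans ((measure_union_le _ _).trans ?_)
      rw [hμE, add_zero]
  · -- The set `E` need not be measurable, but it has a measurable subset `F` that carries `μ`.
    set F := (toMeasurable μ Eᶜ)ᶜ
    have hFE : F ⊆ E := compl_subset_comm.1 (subset_toMeasurable μ Eᶜ)
    have hEF : μ E ≤ μ F := by
      refine (measure_mono ((subset_univ E).trans (union_compl_self F).symm.subset)).trans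
        ((measure_union_le _ _).trans ?_)
      rw [compl_compl, measure_toMeasurable, hμE, add_zero]
    refine hEF.trans ?_
    rw [(measurableSet_toMeasurable μ Eᶜ).compl.measure_eq_iSup_isCompact]
    exact iSup₂_le fun L hL => iSup_le fun hLc => (k.measure_le_capCompact hW hLc).trans
      (k.capCompact_le_capInner hLc (hL.trans hFE))

lemma capInner_of_isCompact {K : Set X} (hK : IsCompact K) : k.capInner K = k.capCompact K :=
  le_antisymm ((k.capInner_le_cap K).trans (k.cap_of_isCompact hK).le)
    (k.capCompact_le_capInner hK Subset.rfl)

end PotentialKernel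
end

/-! ### Continuity along increasing sequences and capacitability of analytic sets -/

section

open Filter Topology
open scoped NNReal CompactlySupported

/-- A quantitative form of the strict convexity of `x ↦ x ^ q` for pairs with `a + b = 1`: on the
compact set of those `s` with `ε (s ^ q + (1 - s) ^ q) / 2 ≤ |s ^ q - (1 - s) ^ q|`, which does not
contain `1 / 2`, the convexity defect has a positive minimum. -/
lemma exists_uniform_convexity_unit {q : ℝ} (hq : 1 < q) {ε : ℝ} (hε : 0 < ε) :
    ∃ C : ℝ, 0 ≤ C ∧ ∀ s ∈ Icc (0 : ℝ) 1,
      |s ^ q - (1 - s) ^ q| ≤ ε * ((s ^ q + (1 - s) ^ q) / 2) +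
        C * ((s ^ q + (1 - s) ^ q) / 2 - (1 / 2) ^ q) := by
  have hq0 : 0 < q := by linarith
  have c1 : Continuous fun s : ℝ => s ^ q := Real.continuous_rpow_const hq0.le
  have c2 : Continuous fun s : ℝ => (1 - s) ^ q := c1.comp (continuous_const.sub continuous_id)
  have hstrict : ∀ s ∈ Icc (0 : ℝ) 1, s ≠ 1 / 2 → 0 < (s ^ q + (1 - s) ^ q) / 2 - (1 / 2) ^ q := by
    intro s hs hne
    obtain ⟨-, hc⟩ := strictConvexOn_rpow hq
    have := hc (mem_Ici.2 hs.1) (mem_Ici.2 (sub_nonneg.2 hs.2)) (fun h => hne (by linarith))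
      (show (0 : ℝ) < 1 / 2 by norm_num) (show (0 : ℝ) < 1 / 2 by norm_num) (by norm_num)
    simp only [smul_eq_mul] at this
    rw [show 1 / 2 * s + 1 / 2 * (1 - s) = 1 / 2 by ring] at this
    linarith
  have hnonneg : ∀ s ∈ Icc (0 : ℝ) 1, 0 ≤ (s ^ q + (1 - s) ^ q) / 2 - (1 / 2) ^ q := by
    intro s hs
    rcases eq_or_ne s (1 / 2) with rfl | h
    · norm_num
    · exact (hstrict s hs h).le
  have hle : ∀ s ∈ Icc (0 : ℝ) 1, |s ^ q - (1 - s) ^ q| ≤ 1 := by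
    intro s hs
    have h1 := Real.rpow_nonneg hs.1 q
    have h2 := Real.rpow_nonneg (sub_nonneg.2 hs.2) q
    have h3 := Real.rpow_le_one hs.1 hs.2 hq0.le
    have h4 := Real.rpow_le_one (sub_nonneg.2 hs.2) (by linarith [hs.1]) hq0.le
    rw [abs_le]; constructor <;> linarith
  set T : Set ℝ := Icc (0 : ℝ) 1 ∩
    {s | ε * ((s ^ q + (1 - s) ^ q) / 2) ≤ |s ^ q - (1 - s) ^ q|}
  have hT : IsCompact T := isCompact_Icc.inter_right (isClosed_le (by fun_prop) (by fun_prop))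
  rcases T.eq_empty_or_nonempty with hTe | hTn
  · refine ⟨0, le_rfl, fun s hs => ?_⟩
    have : s ∉ T := by simp [hTe]
    rw [zero_mul, add_zero]
    exact le_of_not_ge fun h => this ⟨hs, h⟩
  · obtain ⟨s₀, hs₀, hmin⟩ := hT.exists_isMinOn hTn
      (f := fun s : ℝ => (s ^ q + (1 - s) ^ q) / 2 - (1 / 2) ^ q) (by fun_prop)
    have hne : s₀ ≠ 1 / 2 := by
      rintro rfl
      have h := hs₀.2
      simp only [mem_ofPred_eq] at h
      have hp : (0 : ℝ) < (1 / 2) ^ q := by positivity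
      rw [show (1 - 1 / 2 : ℝ) = 1 / 2 by norm_num, sub_self, abs_zero] at h
      nlinarith
    have hm := hstrict s₀ hs₀.1 hne
    set m := (s₀ ^ q + (1 - s₀) ^ q) / 2 - (1 / 2) ^ q
    refine ⟨1 / m, by positivity, fun s hs => ?_⟩
    by_cases hsT : s ∈ T
    · have h1 : m ≤ (s ^ q + (1 - s) ^ q) / 2 - (1 / 2) ^ q := hmin hsT
      have h2 : 1 ≤ 1 / m * ((s ^ q + (1 - s) ^ q) / 2 - (1 / 2) ^ q) := by
        rw [one_div, ← div_eq_inv_mul, le_div_iff₀ hm, one_mul]; exact h1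
      have h3 := Real.rpow_nonneg hs.1 q
      have h4 := Real.rpow_nonneg (sub_nonneg.2 hs.2) q
      have h5 : 0 ≤ ε * ((s ^ q + (1 - s) ^ q) / 2) := by positivity
      linarith [hle s hs]
    · have h1 : |s ^ q - (1 - s) ^ q| ≤ ε * ((s ^ q + (1 - s) ^ q) / 2) :=
        le_of_not_ge fun h => hsT ⟨hs, h⟩
      have h2 := mul_nonneg (one_div_nonneg.2 hm.le) (hnonneg s hs)
      linarith

/-- The preceding estimate for all pairs, by homogeneity. The first difference is truncated. -/
lemma exists_uniform_convexity {q : ℝ} (hq : 1 < q) {ε : ℝ} (hε : 0 < ε) :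
    ∃ C : ℝ≥0, ∀ a b : ℝ≥0, (b ^ q - a ^ q) + C * ((a + b) / 2) ^ q ≤
      (ε.toNNReal + C) * ((a ^ q + b ^ q) / 2) := by
  obtain ⟨C, hC, h⟩ := exists_uniform_convexity_unit hq hε
  have hq0 : 0 < q := by linarith
  refine ⟨C.toNNReal, fun a b => ?_⟩
  rcases eq_or_ne (a + b) 0 with h0 | h0
  · obtain ⟨rfl, rfl⟩ := add_eq_zero.1 h0
    simp [hq0.ne']
  have ht : (0 : ℝ) < a + b := by exact_mod_cast pos_iff_ne_zero.2 h0
  set t : ℝ := a + b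
  have hs := h (a / t) ⟨by positivity, (div_le_one ht).2 (by simp [t])⟩
  have e1 : 1 - (a : ℝ) / t = b / t := by field_simp; simp [t]
  rw [e1, Real.div_rpow a.coe_nonneg ht.le, Real.div_rpow b.coe_nonneg ht.le] at hs
  have htq : 0 < t ^ q := by positivity
  have key : |(a : ℝ) ^ q - b ^ q| + C * (t / 2) ^ q ≤ (ε + C) * ((a ^ q + b ^ q) / 2) := by
    have h2 : (t / 2) ^ q = t ^ q * (1 / 2) ^ q := by
      rw [← Real.mul_rpow ht.le (by norm_num)]; congr 1; ring
    have h1 := mul_le_mul_of_nonneg_left hs htq.le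
    rw [← sub_div, abs_div, abs_of_pos htq, mul_div_cancel₀ _ htq.ne'] at h1
    have h3 : t ^ q * (ε * ((a ^ q / t ^ q + b ^ q / t ^ q) / 2) +
        C * ((a ^ q / t ^ q + b ^ q / t ^ q) / 2 - (1 / 2) ^ q)) =
        (ε + C) * ((a ^ q + b ^ q) / 2) - C * (t ^ q * (1 / 2) ^ q) := by
      field_simp; ring
    rw [h2]
    linarith
  rw [← NNReal.coe_le_coe]
  push_cast
  rw [Real.coe_toNNReal _ hε.le, Real.coe_toNNReal _ hC, NNReal.coe_sub_def]
  push_cast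
  refine le_trans ?_ key
  refine add_le_add_left (max_le ?_ (abs_nonneg _)) _
  rw [abs_sub_comm]
  exact le_abs_self _

namespace PotentialKernel

variable {X ι : Type*} [TopologicalSpace X] (k : PotentialKernel X ι)

lemma tsum_rpow_sub_rpow_le {ε : ℝ} {C : ℝ≥0}
    (hC : ∀ a b : ℝ≥0, (b ^ k.q - a ^ k.q) + C * ((a + b) / 2) ^ k.q ≤
      (ε.toNNReal + C) * ((a ^ k.q + b ^ k.q) / 2))
    {f g : ι → ℝ≥0∞} (hf : ∀ i, f i ≠ ⊤) (hg : ∀ i, g i ≠ ⊤) :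
    (∑' i, k.weight i * (g i ^ k.q - f i ^ k.q)) +
        C * k.modular (fun i => 2⁻¹ * (f i + g i)) ≤
      (ENNReal.ofReal ε + C) * (2⁻¹ * (k.modular f + k.modular g)) := by
  simp only [modular, ← ENNReal.tsum_mul_left, ← ENNReal.tsum_add]
  refine ENNReal.tsum_le_tsum fun i => ?_
  obtain ⟨a, ha⟩ : ∃ a : ℝ≥0, (a : ℝ≥0∞) = f i := ⟨_, ENNReal.coe_toNNReal (hf i)⟩
  obtain ⟨b, hb⟩ : ∃ b : ℝ≥0, (b : ℝ≥0∞) = g i := ⟨_, ENNReal.coe_toNNReal (hg i)⟩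
  have h2 : (2⁻¹ : ℝ≥0∞) = ((2⁻¹ : ℝ≥0) : ℝ≥0∞) := by simp
  rw [← ha, ← hb, h2, ← ENNReal.coe_add, ← ENNReal.coe_mul,
    ← ENNReal.coe_rpow_of_nonneg _ k.q_pos.le,
    ← ENNReal.coe_rpow_of_nonneg _ k.q_pos.le, ← ENNReal.coe_rpow_of_nonneg _ k.q_pos.le,
    ENNReal.ofReal]
  norm_cast
  calc k.weight i * (b ^ k.q - a ^ k.q) + C * (k.weight i * (2⁻¹ * (a + b)) ^ k.q)
      = k.weight i * ((b ^ k.q - a ^ k.q) + C * ((a + b) / 2) ^ k.q) := by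
        rw [div_eq_inv_mul]; ring
    _ ≤ k.weight i * ((ε.toNNReal + C) * ((a ^ k.q + b ^ k.q) / 2)) := by gcongr; exact hC a b
    _ = _ := by rw [div_eq_inv_mul]; ring

/-- If `f` and `g` have modular at most about `L` and their average has modular at least about `L`,
then `f ^ q` and `g ^ q` are close (in a one-sided sense) in weighted `ℓ¹`. -/
lemma exists_tsum_rpow_sub_rpow_le (L : ℝ≥0) {ε : ℝ≥0} (hε : 0 < ε) :
    ∃ δ : ℝ≥0, 0 < δ ∧ ∀ f g : ι → ℝ≥0∞, k.modular f ≤ L + δ → k.modular g ≤ L + δ →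
      L ≤ k.modular (fun i => 2⁻¹ * (f i + g i)) + δ →
      ∑' i, k.weight i * (g i ^ k.q - f i ^ k.q) ≤ ε := by
  set ε' : ℝ≥0 := ε / (2 * (L + 1))
  have hε' : (0 : ℝ) < ε' := by positivity
  obtain ⟨C, hC⟩ := exists_uniform_convexity k.one_lt hε'
  set δ : ℝ≥0 := min 1 (ε / (4 * C + 1))
  refine ⟨δ, by positivity, fun f g hf hg hfg => ?_⟩
  have h := k.tsum_rpow_sub_rpow_le hC
    (k.ne_top_of_modular (ne_top_of_le_ne_top (by finiteness) hf))
    (k.ne_top_of_modular (ne_top_of_le_ne_top (by finiteness) hg))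
  rw [ENNReal.ofReal_coe_nnreal] at h
  have h1 : (2⁻¹ : ℝ≥0∞) * (k.modular f + k.modular g) ≤ L + δ := by
    calc (2⁻¹ : ℝ≥0∞) * (k.modular f + k.modular g) ≤ 2⁻¹ * ((L + δ) + (L + δ)) := by gcongr
      _ = L + δ := by
        rw [← two_mul, ← mul_assoc, ENNReal.inv_mul_cancel (by simp) (by simp), one_mul]
  have h2 : (∑' i, k.weight i * (g i ^ k.q - f i ^ k.q)) + (C * L : ℝ≥0) ≤ ε + (C * L : ℝ≥0) := by
    calc (∑' i, k.weight i * (g i ^ k.q - f i ^ k.q)) + (C * L : ℝ≥0)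
        ≤ (∑' i, k.weight i * (g i ^ k.q - f i ^ k.q)) +
          C * (k.modular (fun i => 2⁻¹ * (f i + g i)) + δ) := by
          rw [ENNReal.coe_mul]; gcongr
      _ = ((∑' i, k.weight i * (g i ^ k.q - f i ^ k.q)) +
          C * k.modular (fun i => 2⁻¹ * (f i + g i))) + C * δ := by ring
      _ ≤ (ε' + C) * (L + δ) + C * δ := by
          gcongr
          exact h.trans (by gcongr)
      _ ≤ ε + (C * L : ℝ≥0) := by
          norm_cast
          have d1 : δ ≤ 1 := min_le_left _ _
          have d2 : δ * (4 * C + 1) ≤ ε := by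
            rw [← le_div_iff₀ (by positivity)]; exact min_le_right _ _
          have d3 : ε' * (2 * (L + 1)) = ε := div_mul_cancel₀ _ (by positivity)
          have d4 : ε' * δ ≤ ε' * 1 := by gcongr
          rw [← NNReal.coe_le_coe] at d2 d4 ⊢
          rw [← NNReal.coe_inj] at d3
          push_cast at d2 d3 d4 ⊢
          nlinarith [δ.coe_nonneg, C.coe_nonneg]
  exact (ENNReal.add_le_add_iff_right ENNReal.coe_ne_top).1 h2

/-- Telescoping bound for the supremum of a sequence; the differences are truncated. -/
lemma modular_iSup_le (f : ℕ → ι → ℝ≥0∞) :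
    k.modular (fun i => ⨆ n, f n i) ≤ k.modular (f 0) +
      ∑' n, ∑' i, k.weight i * (f (n + 1) i ^ k.q - f n i ^ k.q) := by
  rw [ENNReal.tsum_comm]
  simp only [modular, ← ENNReal.tsum_add]
  refine ENNReal.tsum_le_tsum fun i => ?_
  rw [ENNReal.tsum_mul_left, ← mul_add]
  gcongr
  rw [← ENNReal.le_rpow_inv_iff k.q_pos]
  refine iSup_le fun n => ?_
  rw [ENNReal.le_rpow_inv_iff k.q_pos]
  have : ∀ n, f n i ^ k.q ≤ f 0 i ^ k.q +
      ∑ j ∈ Finset.range n, (f (j + 1) i ^ k.q - f j i ^ k.q) := by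
    intro n
    induction n with
    | zero => simp
    | succ n ih =>
      rw [Finset.sum_range_succ, ← add_assoc]
      refine (le_tsub_add (a := f n i ^ k.q)).trans ?_
      rw [add_comm]
      gcongr
  refine (this n).trans ?_
  gcongr
  exact ENNReal.sum_le_tsum _

end PotentialKernel

namespace PotentialKernel

variable {X ι : Type*} [MetricSpace X] [ProperSpace X] [MeasurableSpace X] [BorelSpace X]
  [Countable ι] (k : PotentialKernel X ι)

lemma exists_modular_lt {E : Set X} {r : ℝ≥0∞} (h : k.cap E < r) :
    ∃ f : ι → ℝ≥0∞, k.modular f < r ∧ k.cap {z ∈ E | k.pot f z < 1} = 0 := by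
  rw [cap_eq_infEnergy] at h
  obtain ⟨μ, hμ⟩ := iInf_lt_iff.1 h
  obtain ⟨h1, h2⟩ := iInf_lt_iff.1 hμ
  exact ⟨_, (k.modular_wolff μ).trans_lt h2, h1.2⟩

/-- The capacity is continuous along increasing sequences of arbitrary sets. -/
theorem cap_iUnion_of_monotone {E : ℕ → Set X} (hE : Monotone E) :
    k.cap (⋃ n, E n) = ⨆ n, k.cap (E n) := by
  refine le_antisymm ?_ (iSup_le fun n => k.cap_mono (subset_iUnion E n))
  rcases eq_or_ne (⨆ n, k.cap (E n)) ⊤ with hL | hL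
  · rw [hL]; exact le_top
  obtain ⟨L, hL'⟩ : ∃ L : ℝ≥0, (L : ℝ≥0∞) = ⨆ n, k.cap (E n) := ⟨_, ENNReal.coe_toNNReal hL⟩
  rw [← hL']
  have hcapL : ∀ n, k.cap (E n) ≤ L := fun n => hL' ▸ le_iSup (fun n => k.cap (E n)) n
  have hex : ∀ n : ℕ, ∃ f : ι → ℝ≥0∞, k.modular f < k.cap (E n) + ((n : ℝ≥0∞) + 1)⁻¹ ∧
      k.cap {z ∈ E n | k.pot f z < 1} = 0 := fun n =>
    k.exists_modular_lt (ENNReal.lt_add_right (ne_top_of_le_ne_top ENNReal.coe_ne_top (hcapL n))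
      (by simp))
  choose f hf hfE using hex
  have hinv : Tendsto (fun n : ℕ => ((n : ℝ≥0∞) + 1)⁻¹) atTop (𝓝 0) := by
    have := (tendsto_add_atTop_iff_nat 1).2 ENNReal.tendsto_inv_nat_nhds_zero
    simpa using this
  have hsmall : ∀ δ : ℝ≥0, 0 < δ → ∀ᶠ n in atTop, ∀ m ≥ n, k.modular (f m) ≤ L + δ := by
    intro δ hδ
    have h1 := (hinv.eventually (gt_mem_nhds (ENNReal.coe_pos.2 hδ)))
    obtain ⟨N, hN⟩ := eventually_atTop.1 h1
    filter_upwards [eventually_ge_atTop N] with n hn m hm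
    exact (hf m).le.trans (add_le_add (hcapL m) (hN m (hn.trans hm)).le)
  -- The average of `f n` and `f m` is a test sequence for `E n` if `n ≤ m`, so its modular is at
  -- least `L - δ` when `n` is large.
  have havg : ∀ δ : ℝ≥0, 0 < δ → ∀ᶠ n in atTop, ∀ m ≥ n,
      (L : ℝ≥0∞) ≤ k.modular (fun i => 2⁻¹ * (f n i + f m i)) + δ := by
    intro δ hδ
    rcases eq_or_ne L 0 with rfl | hL0
    · exact Eventually.of_forall fun _ _ _ => zero_le
    have h1 : (L : ℝ≥0∞) - δ < ⨆ n, k.cap (E n) := by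
      rw [← hL']
      exact ENNReal.sub_lt_self ENNReal.coe_ne_top (by simpa using hL0) (by simpa using hδ.ne')
    obtain ⟨N, hN⟩ := lt_iSup_iff.1 h1
    filter_upwards [eventually_ge_atTop N] with n hn m hm
    have h2 : k.cap (E n) ≤ k.modular (fun i => 2⁻¹ * (f n i + f m i)) := by
      refine k.cap_le_modular (k.cap_eq_zero_of_subset (F := {z ∈ E n | k.pot (f n) z < 1} ∪
        {z ∈ E m | k.pot (f m) z < 1}) ?_ ?_)
      · rintro z ⟨hz, hlt⟩
        by_contra hcon
        simp only [mem_union, mem_ofPred_eq, not_or, not_and, not_lt] at hcon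
        rw [pot_smul, pot_add] at hlt
        refine absurd hlt (not_lt.2 ?_)
        calc (1 : ℝ≥0∞) = 2⁻¹ * (1 + 1) := by
              rw [one_add_one_eq_two, ENNReal.inv_mul_cancel (by simp) (by simp)]
          _ ≤ _ := by gcongr; exacts [hcon.1 hz, hcon.2 (hE hm hz)]
      · refine le_antisymm ((k.cap_union_le _ _).trans ?_) zero_le
        rw [hfE, hfE, add_zero]
    rw [← tsub_le_iff_right]
    exact hN.le.trans ((k.cap_mono (hE hn)).trans h2)
  refine ENNReal.le_of_forall_pos_le_add fun ε hε _ => ?_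
  have hε2 : (0 : ℝ≥0) < ε / 2 := by positivity
  obtain ⟨e, he, hesum⟩ := ENNReal.exists_pos_sum_of_countable (ι := ℕ) (ε := (ε / 2 : ℝ≥0))
    (by simpa using hε.ne')
  obtain ⟨φ, hφ, hP⟩ := extraction_forall_of_eventually
    (P := fun j n => k.modular (f n) ≤ L + (ε / 2 : ℝ≥0) ∧
      ∀ m ≥ n, ∑' i, k.weight i * (f m i ^ k.q - f n i ^ k.q) ≤ e j) fun j => by
    obtain ⟨δ, hδ, hδD⟩ := k.exists_tsum_rpow_sub_rpow_le L (he j)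
    filter_upwards [hsmall _ hε2, hsmall δ hδ, havg δ hδ] with n h1 h2 h3
    exact ⟨h1 n le_rfl, fun m hm => hδD _ _ (h2 n le_rfl) (h2 m hm) (h3 m hm)⟩
  -- The supremum `g` of the subsequence dominates test sequences for all `E (φ j)`.
  set g : ι → ℝ≥0∞ := fun i => ⨆ j, f (φ j) i
  have hg : k.cap (⋃ n, E n) ≤ k.modular g := by
    refine k.cap_le_modular (k.cap_eq_zero_of_subset
      (F := ⋃ j, {z ∈ E (φ j) | k.pot (f (φ j)) z < 1}) ?_
      (k.cap_iUnion_eq_zero fun j => hfE _))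
    rintro z ⟨hz, hlt⟩
    obtain ⟨n, hn⟩ := mem_iUnion.1 hz
    exact mem_iUnion.2 ⟨n, hE (hφ.id_le n) hn,
      (k.pot_mono (fun i => le_iSup (fun j => f (φ j) i) n) z).trans_lt hlt⟩
  calc k.cap (⋃ n, E n) ≤ k.modular g := hg
    _ ≤ k.modular (f (φ 0)) +
        ∑' n, ∑' i, k.weight i * (f (φ (n + 1)) i ^ k.q - f (φ n) i ^ k.q) :=
        k.modular_iSup_le fun j => f (φ j)
    _ ≤ (L + (ε / 2 : ℝ≥0)) + ∑' n, (e n : ℝ≥0∞) := by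
        gcongr with n
        · exact (hP 0).1
        · exact (hP n).2 _ (hφ.monotone (Nat.le_succ n))
    _ ≤ (L + (ε / 2 : ℝ≥0)) + (ε / 2 : ℝ≥0) := by gcongr
    _ = L + ε := by rw [add_assoc, ← ENNReal.coe_add, add_halves]

end PotentialKernel

lemma isCompact_setOf_forall_le (n : ℕ → ℕ) : IsCompact {x : ℕ → ℕ | ∀ i, x i ≤ n i} := by
  have := isCompact_univ_pi fun i => (finite_Iic (n i)).isCompact
  convert this using 1
  ext x
  simp [Pi.le_def]

/-- A neighbourhood of a compact box in Baire space contains a box with finitely many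
constraints. -/
lemma exists_initial_segment_subset {n : ℕ → ℕ} {V : Set (ℕ → ℕ)} (hV : IsOpen V)
    (h : {x | ∀ i, x i ≤ n i} ⊆ V) : ∃ j, {x | ∀ i < j, x i ≤ n i} ⊆ V := by
  have hK : IsCompact {x : ℕ → ℕ | ∀ i, x i ≤ n i} := isCompact_setOf_forall_le n
  have key : ∃ j, ∀ x ∈ {x : ℕ → ℕ | ∀ i, x i ≤ n i},
      ∀ y : ℕ → ℕ, (∀ i < j, y i = x i) → y ∈ V := by
    refine hK.induction_on (p := fun S => ∃ j, ∀ x ∈ S, ∀ y : ℕ → ℕ, (∀ i < j, y i = x i) → y ∈ V)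
      ⟨0, by simp⟩ ?_ ?_ ?_
    · rintro s t hst ⟨j, hj⟩
      exact ⟨j, fun x hx => hj x (hst hx)⟩
    · rintro s t ⟨j, hj⟩ ⟨j', hj'⟩
      refine ⟨max j j', ?_⟩
      rintro x (hx | hx) y hy
      · exact hj x hx y fun i hi => hy i (lt_max_of_lt_left hi)
      · exact hj' x hx y fun i hi => hy i (lt_max_of_lt_right hi)
    · intro x hx
      obtain ⟨W, ⟨y, j, rfl⟩, hxW, hWV⟩ :=
        (PiNat.isTopologicalBasis_cylinders (fun _ : ℕ => ℕ)).exists_subset_of_mem_open (h hx) hV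
      refine ⟨_, mem_nhdsWithin_of_mem_nhds ((PiNat.isOpen_cylinder _ y j).mem_nhds hxW), j,
        fun x' hx' z hz => hWV ?_⟩
      rw [PiNat.mem_cylinder_iff] at hx' ⊢
      exact fun i hi => (hz i hi).trans (hx' i hi)
  obtain ⟨j, hj⟩ := key
  exact ⟨j, fun x hx => hj (fun i => min (x i) (n i)) (fun i => min_le_right _ _) x
    fun i hi => (min_eq_left (hx i hi)).symm⟩

namespace PotentialKernel

variable {X ι : Type*} [MetricSpace X] [ProperSpace X] [MeasurableSpace X] [BorelSpace X]
  [Countable ι] (k : PotentialKernel X ι)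

/-- Choquet's capacitability theorem for the capacity of a kernel. -/
theorem cap_eq_capInner_of_analyticSet {E : Set X} (hE : AnalyticSet E) :
    k.cap E = k.capInner E := by
  refine le_antisymm (le_of_forall_lt fun r hr => ?_) (k.capInner_le_cap E)
  rw [AnalyticSet] at hE
  rcases hE with rfl | ⟨f, hf, rfl⟩
  · rwa [k.cap_of_isCompact isCompact_empty, ← k.capInner_of_isCompact isCompact_empty] at hr
  obtain ⟨r', hrr', hr'⟩ := exists_between hr
  refine hrr'.trans_le ?_
  have step : ∀ (j : ℕ) (S : {S : Set (ℕ → ℕ) // r' < k.cap (f '' S)}),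
      ∃ m, r' < k.cap (f '' (S.1 ∩ {x | x j ≤ m})) := by
    rintro j ⟨S, hS⟩
    have h1 : f '' S = ⋃ m, f '' (S ∩ {x | x j ≤ m}) := by
      rw [← image_iUnion, ← inter_iUnion]
      congr 1
      refine (inter_eq_left.2 fun x _ => mem_iUnion.2 ⟨x j, le_refl (x j)⟩).symm
    have hmono : Monotone fun m => f '' (S ∩ {x | x j ≤ m}) := fun a b hab =>
      image_mono fun x (hx : x ∈ S ∧ x j ≤ a) => ⟨hx.1, hx.2.trans hab⟩
    rw [h1, k.cap_iUnion_of_monotone hmono] at hS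
    exact lt_iSup_iff.1 hS
  -- The bounds `n j` are chosen one coordinate at a time, keeping the capacity of the image above
  -- `r'`; the image of the box with all constraints is the compact set looked for.
  choose m hm using step
  let S : ℕ → {S : Set (ℕ → ℕ) // r' < k.cap (f '' S)} := fun j =>
    Nat.rec ⟨univ, by rwa [image_univ]⟩ (fun j S => ⟨S.1 ∩ {x | x j ≤ m j S}, hm j S⟩) j
  set n : ℕ → ℕ := fun j => m j (S j)
  have hS : ∀ j, (S j).1 = {x | ∀ i < j, x i ≤ n i} := by
    intro j
    induction j with
    | zero => simp [S]
    | succ j ih =>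
      have : (S (j + 1)).1 = (S j).1 ∩ {x | x j ≤ n j} := rfl
      rw [this, ih]
      ext x
      exact (Nat.forall_lt_succ_right (p := fun i => x i ≤ n i)).symm
  have hK : IsCompact {x : ℕ → ℕ | ∀ i, x i ≤ n i} := isCompact_setOf_forall_le n
  refine le_trans ?_ (k.capCompact_le_capInner (hK.image hf) (image_subset_range _ _))
  rw [← k.cap_of_isCompact (hK.image hf)]
  refine le_iInf₂ fun U (hU : IsOpen U ∧ _ ⊆ U) => ?_
  obtain ⟨j, hj⟩ := exists_initial_segment_subset (hU.1.preimage hf) (image_subset_iff.1 hU.2)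
  have := (S j).2
  rw [hS] at this
  rw [← k.cap_of_isOpen hU.1]
  exact this.le.trans (k.cap_mono (image_subset_iff.2 hj))

end PotentialKernel
end

/-! ### Parabolic dyadic lattices are locally finite at fixed scale -/

section

open Filter Topology
open scoped NNReal CompactlySupported

lemma finite_grid_inter_Icc {s : ℝ} (hs : 0 < s) (c a b : ℝ) :
    {x : ℝ | (∃ k : ℤ, x = c + k * s) ∧ x ∈ Icc a b}.Finite := by
  refine ((finite_Icc ⌈(a - c) / s⌉ ⌊(b - c) / s⌋).image fun k : ℤ => c + k * s).subset ?_
  rintro x ⟨⟨k, rfl⟩, hx1, hx2⟩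
  refine ⟨k, ⟨Int.ceil_le.2 ?_, Int.le_floor.2 ?_⟩, rfl⟩
  · rw [div_le_iff₀ hs]; linarith
  · rw [le_div_iff₀ hs]; linarith

lemma countable_grid (c s : ℝ) : {x : ℝ | ∃ k : ℤ, x = c + k * s}.Countable := by
  refine (countable_range fun k : ℤ => c + k * s).mono ?_
  rintro x ⟨k, rfl⟩
  exact ⟨k, rfl⟩

namespace ParabolicCapacity

variable {d : ℕ}

/-- The parameters of a rectangle as a point of a product, for counting rectangles. -/
def Rect.params (R : Rect d) : ℝ × (Fin d → ℝ) × ℝ := (R.side, R.corner, R.time)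

lemma Rect.params_injective : Function.Injective (Rect.params (d := d)) := by
  rintro ⟨c, t, s, hs⟩ ⟨c', t', s', hs'⟩ h
  simp only [Rect.params, Prod.mk.injEq] at h
  obtain ⟨rfl, rfl, rfl⟩ := h
  rfl

/-- The rectangles of a lattice with sidelength at least `Q.side / 2 ^ J` have their parameters
on a common grid. -/
lemma IsLattice.params_mem_grid {𝒟 : Set (Rect d)} (h𝒟 : IsLattice 𝒟) {Q R : Rect d}
    (hQ : Q ∈ 𝒟) (hR : R ∈ 𝒟) {J : ℕ} (hJ : Q.side / 2 ^ J ≤ R.side) :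
    (∃ k : ℤ, R.side = 0 + k * (Q.side / 2 ^ J)) ∧
      (∀ i, ∃ k : ℤ, R.corner i = Q.corner i + k * (Q.side / 2 ^ J)) ∧
      ∃ k : ℤ, R.time = Q.time + k * (Q.side / 2 ^ J) ^ 2 := by
  obtain ⟨P, -, ⟨j, hjs, hjc, m, -, hjt⟩, ⟨l, hls, hlc, n, -, hlt⟩⟩ := h𝒟.common R hR Q hQ
  have hP := P.side_pos
  set s := Q.side / 2 ^ J
  have hs : s = P.side / 2 ^ (l + J) := by simp only [s, hls, pow_add]; field_simp
  have hjle : j ≤ l + J := by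
    rw [hs, hjs, div_le_div_iff_of_pos_left hP (by positivity) (by positivity)] at hJ
    exact (pow_le_pow_iff_right₀ (by norm_num : (1 : ℝ) < 2)).1 hJ
  obtain ⟨e, he⟩ := Nat.exists_eq_add_of_le hjle
  have hRs : R.side = 2 ^ e * s := by
    rw [hs, he, hjs, pow_add]; field_simp
  have hQs : Q.side = 2 ^ J * s := by simp only [s]; field_simp
  refine ⟨⟨2 ^ e, by rw [hRs]; push_cast; ring⟩, fun i => ?_, ?_⟩
  · obtain ⟨a, -, ha⟩ := hjc i
    obtain ⟨b, -, hb⟩ := hlc i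
    refine ⟨a * 2 ^ e - b * 2 ^ J, ?_⟩
    have : P.corner i = Q.corner i - b * Q.side := by linarith
    rw [ha, this, hRs, hQs]; push_cast; ring
  · refine ⟨n * (2 ^ J) ^ 2 - m * (2 ^ e) ^ 2, ?_⟩
    have : P.time = Q.time + n * Q.side ^ 2 := by linarith
    rw [hjt, this, hRs, hQs]; push_cast; ring

lemma IsLattice.nonempty {𝒟 : Set (Rect d)} (h𝒟 : IsLattice 𝒟) : 𝒟.Nonempty := by
  obtain ⟨Q, hQ, -⟩ := h𝒟.exhaust ∅ isCompact_empty (empty_subset _)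
  exact ⟨Q, hQ⟩

lemma exists_div_two_pow_le (a : ℝ) {b : ℝ} (hb : 0 < b) : ∃ J : ℕ, a / 2 ^ J ≤ b := by
  obtain ⟨J, hJ⟩ := pow_unbounded_of_one_lt (a / b) (one_lt_two (α := ℝ))
  refine ⟨J, ?_⟩
  rw [div_lt_iff₀ hb] at hJ
  rw [div_le_iff₀ (by positivity)]
  linarith

theorem IsLattice.countable {𝒟 : Set (Rect d)} (h𝒟 : IsLattice 𝒟) : 𝒟.Countable := by
  obtain ⟨Q, hQ⟩ := h𝒟.nonempty
  have hcover : 𝒟 ⊆ ⋃ J : ℕ, Rect.params ⁻¹' ({x | ∃ k : ℤ, x = 0 + k * (Q.side / 2 ^ J)} ×ˢ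
      (univ.pi fun i => {x | ∃ k : ℤ, x = Q.corner i + k * (Q.side / 2 ^ J)}) ×ˢ
      {x | ∃ k : ℤ, x = Q.time + k * (Q.side / 2 ^ J) ^ 2}) := fun R hR => by
    obtain ⟨J, hJ⟩ := exists_div_two_pow_le Q.side R.side_pos
    obtain ⟨h1, h2, h3⟩ := h𝒟.params_mem_grid hQ hR hJ
    exact mem_iUnion.2 ⟨J, h1, fun i _ => h2 i, h3⟩
  refine (countable_iUnion fun J => Countable.preimage_of_injOn ?_
    Rect.params_injective.injOn).mono hcover
  exact (countable_grid _ _).prod ((countable_univ_pi fun i => countable_grid _ _).prod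
    (countable_grid _ _))

lemma IsLattice.finite_of_bounded {𝒟 : Set (Rect d)} (h𝒟 : IsLattice 𝒟) {ε : ℝ} (hε : 0 < ε)
    (z : SpaceTime d) (B : ℝ) :
    {R ∈ 𝒟 | ε ≤ R.side ∧ R.side ≤ 1 ∧ (∀ i, |R.corner i - z.1 i| ≤ B) ∧
      |R.time - z.2| ≤ B}.Finite := by
  obtain ⟨Q, hQ⟩ := h𝒟.nonempty
  obtain ⟨J, hJ⟩ := exists_div_two_pow_le Q.side hε
  have hs : 0 < Q.side / 2 ^ J := div_pos Q.side_pos (by positivity)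
  have hfin : (({x : ℝ | (∃ k : ℤ, x = 0 + k * (Q.side / 2 ^ J)) ∧ x ∈ Icc 0 1}) ×ˢ
      (univ.pi fun i => {x : ℝ | (∃ k : ℤ, x = Q.corner i + k * (Q.side / 2 ^ J)) ∧
        x ∈ Icc (z.1 i - B) (z.1 i + B)}) ×ˢ
      {x : ℝ | (∃ k : ℤ, x = Q.time + k * (Q.side / 2 ^ J) ^ 2) ∧
        x ∈ Icc (z.2 - B) (z.2 + B)}).Finite :=
    (finite_grid_inter_Icc hs _ _ _).prod ((Finite.pi fun i => finite_grid_inter_Icc hs _ _ _).prod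
      (finite_grid_inter_Icc (by positivity) _ _ _))
  refine (hfin.preimage Rect.params_injective.injOn).subset ?_
  rintro R ⟨hR, h1, h2, h3, h4⟩
  obtain ⟨g1, g2, g3⟩ := h𝒟.params_mem_grid hQ hR (hJ.trans h1)
  have bound : ∀ {x y : ℝ}, |x - y| ≤ B → x ∈ Icc (y - B) (y + B) := fun h => by
    rw [abs_le] at h
    constructor <;> linarith
  exact ⟨⟨g1, R.side_pos.le, h2⟩, fun i _ => ⟨g2 i, bound (h3 i)⟩, g3, bound h4⟩

/-- The centre of the time-backward rectangle `Q × (t - ℓ², t)`. -/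
noncomputable def Rect.center (R : Rect d) : SpaceTime d :=
  (WithLp.toLp 2 fun i => R.corner i + R.side / 2, R.time - R.side ^ 2 / 2)

/-- Every small rectangle of a lattice lies in a rectangle of the lattice of a prescribed larger
dyadic sidelength. -/
lemma IsLattice.exists_ancestor {𝒟 : Set (Rect d)} (h𝒟 : IsLattice 𝒟) {Q R : Rect d}
    (hQ : Q ∈ 𝒟) (hR : R ∈ 𝒟) {J : ℕ} (hJ : R.side ≤ Q.side / 2 ^ J) :
    ∃ P ∈ 𝒟, P.side = Q.side / 2 ^ J ∧ R.center ∈ P.toSet := by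
  obtain ⟨T, hT, ⟨j, hjs, hjc, m, hm, hjt⟩, ⟨l, hls, -⟩⟩ := h𝒟.common R hR Q hQ
  have hTpos := T.side_pos
  set s := Q.side / 2 ^ J
  have hs : s = T.side / 2 ^ (l + J) := by simp only [s, hls, pow_add]; field_simp
  have hspos : 0 < s := by rw [hs]; positivity
  have hjle : l + J ≤ j := by
    rw [hs, hjs, div_le_div_iff_of_pos_left hTpos (by positivity) (by positivity)] at hJ
    exact (pow_le_pow_iff_right₀ (by norm_num : (1 : ℝ) < 2)).1 hJ
  obtain ⟨e, he⟩ := Nat.exists_eq_add_of_le hjle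
  choose a ha hac using hjc
  have hR0 := R.side_pos
  have hsR : s = 2 ^ e * R.side := by
    rw [hs, hjs, he, pow_add _ (l + J)]; field_simp
  let P : Rect d := ⟨fun i => T.corner i + (a i / 2 ^ e : ℕ) * s,
    T.time - (m / 4 ^ e : ℕ) * s ^ 2, s, hspos⟩
  have hPT : P.IsDyadicSub T := by
    refine ⟨l + J, hs, fun i => ⟨a i / 2 ^ e, ?_, rfl⟩, m / 4 ^ e, ?_, rfl⟩
    · rw [Nat.div_lt_iff_lt_mul (by positivity), ← pow_add, ← he]; exact ha i
    · rw [Nat.div_lt_iff_lt_mul (by positivity), ← pow_add, ← he]; exact hm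
  refine ⟨P, h𝒟.sub_mem T hT P hPT, rfl, ⟨fun i => ?_, ?_⟩⟩
  · have h1 : ((a i / 2 ^ e : ℕ) : ℝ) * 2 ^ e ≤ a i := by exact_mod_cast Nat.div_mul_le_self _ _
    have h2 : (a i : ℝ) + 1 ≤ ((a i / 2 ^ e : ℕ) + 1 : ℝ) * 2 ^ e := by
      have := Nat.lt_mul_div_succ (a i) (show 0 < 2 ^ e by positivity)
      rw [mul_comm] at this
      exact_mod_cast Nat.succ_le_of_lt this
    have h3 := mul_le_mul_of_nonneg_right h1 hR0.le
    have h4 := mul_le_mul_of_nonneg_right h2 hR0.le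
    simp only [P, Rect.center, hac, hsR]
    constructor <;> nlinarith
  · have h1 : ((m / 4 ^ e : ℕ) : ℝ) * 4 ^ e ≤ m := by exact_mod_cast Nat.div_mul_le_self _ _
    have h2 : (m : ℝ) + 1 ≤ ((m / 4 ^ e : ℕ) + 1 : ℝ) * 4 ^ e := by
      have := Nat.lt_mul_div_succ m (show 0 < 4 ^ e by positivity)
      rw [mul_comm] at this
      exact_mod_cast Nat.succ_le_of_lt this
    have hR2 : 0 < R.side ^ 2 := by positivity
    have h3 := mul_le_mul_of_nonneg_right h1 hR2.le
    have h4 := mul_le_mul_of_nonneg_right h2 hR2.le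
    have h5 : s ^ 2 = 4 ^ e * R.side ^ 2 := by
      rw [hsR, mul_pow, ← pow_mul, mul_comm e 2, pow_mul]; norm_num
    simp only [P, Rect.center, hjt, h5]
    constructor <;> nlinarith

lemma exists_box_subset {z : SpaceTime d} {W : Set (SpaceTime d)} (hW : W ∈ 𝓝 z) :
    ∃ ρ > 0, ∀ w : SpaceTime d, (∀ i, |w.1 i - z.1 i| < ρ) → |w.2 - z.2| < ρ → w ∈ W := by
  let e : (Fin d → ℝ) × ℝ → SpaceTime d := fun u => (WithLp.toLp 2 u.1, u.2)
  have he : Continuous e := by fun_prop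
  have h1 : e ⁻¹' W ∈ 𝓝 ((fun i => z.1 i, z.2) : (Fin d → ℝ) × ℝ) := he.continuousAt hW
  obtain ⟨ρ, hρ, hsub⟩ := Metric.mem_nhds_iff.1 h1
  refine ⟨ρ, hρ, fun w hw ht => ?_⟩
  have : ((fun i => w.1 i, w.2) : (Fin d → ℝ) × ℝ) ∈ e ⁻¹' W := by
    apply hsub
    rw [Metric.mem_ball, Prod.dist_eq, max_lt_iff, dist_pi_lt_iff hρ]
    exact ⟨fun i => by simpa [Real.dist_eq] using hw i, by simpa [Real.dist_eq] using ht⟩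
  exact this

/-- Near a point `z` where all cutoffs of rectangles of sidelength less than one vanish, only
finitely many of them do not vanish identically. Small rectangles lie in one of the finitely many
rectangles near `z` of a fixed sidelength `s < 1`, whose cutoffs are small near `z`; so they keep a
distance from `z`, and those meeting a neighbourhood of `z` have sidelength bounded below. -/
theorem finite_cutoffs_near {𝒟 : Set (Rect d)} (h𝒟 : IsLattice 𝒟) {η : Rect d → SpaceTime d → ℝ}
    (hη : ∀ R ∈ 𝒟, IsCutoff R (η R)) {z : SpaceTime d}
    (hz : ∀ R ∈ 𝒟, R.side < 1 → η R z ≤ 0) :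
    ∃ V ∈ 𝓝 z, {R ∈ 𝒟 | R.side < 1 ∧ ∃ y ∈ V, 0 < η R y}.Finite := by
  obtain ⟨Q, hQ⟩ := h𝒟.nonempty
  obtain ⟨J, hJ⟩ := exists_div_two_pow_le Q.side (show (0 : ℝ) < 1 / 2 by norm_num)
  set s := Q.side / 2 ^ J
  have hs : 0 < s := div_pos Q.side_pos (by positivity)
  have hs1 : s < 1 := by linarith
  set N := {P ∈ 𝒟 | s ≤ P.side ∧ P.side ≤ 1 ∧ (∀ i, |P.corner i - z.1 i| ≤ 2) ∧
      |P.time - z.2| ≤ 2}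
  have hN : N.Finite := h𝒟.finite_of_bounded hs z 2
  have hW : ⋂ P ∈ {P ∈ N | P.side < 1}, {w | η P w < 1} ∈ 𝓝 z := by
    refine (biInter_mem (hN.subset (sep_subset _ _))).2 fun P hP => ?_
    refine (isOpen_lt (hη P hP.1.1).smooth.continuous continuous_const).mem_nhds ?_
    exact (hz P hP.1.1 hP.2).trans_lt one_pos
  obtain ⟨ρ, hρ, hρW⟩ := exists_box_subset hW
  set σ := min ρ 1
  have hσ : 0 < σ := lt_min hρ one_pos
  have hσ1 : σ ≤ 1 := min_le_right _ _
  have hσρ : σ ≤ ρ := min_le_left _ _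
  refine ⟨{y | (∀ i, |y.1 i - z.1 i| < σ / 2) ∧ |y.2 - z.2| < σ / 2}, ?_, ?_⟩
  · refine IsOpen.mem_nhds ?_ ⟨fun i => by simpa using hσ, by simpa using hσ⟩
    simp only [ofPred_and, ofPred_forall]
    exact (isOpen_iInter_of_finite fun i => isOpen_lt (by fun_prop) continuous_const).inter
      (isOpen_lt (by fun_prop) continuous_const)
  · refine (h𝒟.finite_of_bounded (lt_min hs (show 0 < σ / 20 by positivity)) z 12).subset ?_
    rintro R ⟨hR, hR1, y, ⟨hy1, hy2⟩, hy⟩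
    have hR0 := R.side_pos
    have hyR : y ∈ R.dilate 3 := by
      by_contra hcon
      have := (hη R hR).upper y
      rw [indicator_of_notMem hcon] at this
      linarith
    obtain ⟨hd1, hd2, hd3⟩ := hyR
    have hsq : R.side ^ 2 ≤ R.side := by nlinarith
    refine ⟨hR, ?_, hR1.le, fun i => ?_, ?_⟩
    · -- A very small `R` has its centre in some `P ∈ N`, where `η P ≥ 1`, and close to `z`, where
      -- `η P < 1`.
      by_contra! hlt
      obtain ⟨hlt1, hlt2⟩ := lt_min_iff.1 hlt
      obtain ⟨P, hP, hPs, hPR⟩ := h𝒟.exists_ancestor hQ hR hlt1.le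
      have hc1 : ∀ i, |R.center.1 i - z.1 i| < σ := fun i => by
        have h1 := abs_lt.1 (hd1 i)
        have h2 := abs_lt.1 (hy1 i)
        have h3 : R.center.1 i = R.corner i + R.side / 2 := rfl
        rw [h3, abs_lt]
        constructor <;> linarith [h1.1, h1.2, h2.1, h2.2]
      have hc2 : |R.center.2 - z.2| < σ := by
        have h2 := abs_lt.1 hy2
        have h3 : R.center.2 = R.time - R.side ^ 2 / 2 := rfl
        rw [h3, abs_lt]
        constructor <;> linarith [h2.1, h2.2]
      have hPN : P ∈ N := by
        refine ⟨hP, hPs.symm.le, hPs.le.trans hs1.le, fun i => ?_, ?_⟩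
        · have h1 := abs_lt.1 (hc1 i)
          have h2 := hPR.1 i
          rw [hPs] at h2
          rw [abs_le]
          constructor <;> linarith [h1.1, h1.2, h2.1, h2.2]
        · have h1 := abs_lt.1 hc2
          have h2 := hPR.2
          rw [hPs] at h2
          have h3 : s ^ 2 ≤ s := by nlinarith
          rw [abs_le]
          constructor <;> linarith [h1.1, h1.2, h2.1, h2.2]
      have h1 := hρW R.center (fun i => (hc1 i).trans_le hσρ) (hc2.trans_le hσρ)
      have h2 : η P R.center < 1 := mem_iInter₂.1 h1 P ⟨hPN, hPs.trans_lt hs1⟩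
      have h3 := (hη P hP).lower R.center
      rw [indicator_of_mem hPR] at h3
      linarith
    · have h1 := abs_lt.1 (hd1 i)
      have h2 := abs_lt.1 (hy1 i)
      rw [abs_le]
      constructor <;> linarith [h1.1, h1.2, h2.1, h2.2]
    · have h2 := abs_lt.1 hy2
      rw [abs_le]
      constructor <;> linarith [h2.1, h2.2]

end ParabolicCapacity

end

/-! ### The kernel of a parabolic dyadic lattice -/

section

open Filter Topology
open scoped NNReal CompactlySupported

namespace ParabolicCapacity

variable {d : ℕ} {𝒟 : Set (Rect d)} {η : Rect d → SpaceTime d → ℝ} {α q : ℝ}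

/-- The cutoffs of the rectangles of sidelength less than one in a parabolic dyadic lattice, as a
kernel. The weights are `(ℓ_R ^ (αq - n)) ^ (q' - 1)` with `n = d + 2`. -/
noncomputable def latticeKernel (h𝒟 : IsLattice 𝒟) (hη : ∀ R ∈ 𝒟, IsCutoff R (η R)) (α : ℝ)
    (hq : 1 < q) : PotentialKernel (SpaceTime d) {R : Rect d // R ∈ 𝒟 ∧ R.side < 1} where
  weight R := (R.1.side ^ (α * q - ((d : ℝ) + 2))).toNNReal ^ (q.conjExponent - 1)
  weight_pos R := NNReal.rpow_pos (Real.toNNReal_pos.2 (Real.rpow_pos_of_pos R.1.side_pos _))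
  fn R := ⟨⟨fun z => (η R.1 z).toNNReal,
    continuous_real_toNNReal.comp (hη R.1 R.2.1).smooth.continuous⟩,
    (hη R.1 R.2.1).compact.comp_left (g := Real.toNNReal) Real.toNNReal_zero⟩
  q := q
  one_lt := hq
  finite_near z hz := by
    obtain ⟨V, hV, hfin⟩ := finite_cutoffs_near h𝒟 hη (z := z) fun R hR hR1 =>
      Real.toNNReal_eq_zero.1 (hz ⟨R, hR, hR1⟩)
    refine ⟨V, hV, (hfin.preimage Subtype.val_injective.injOn).subset ?_⟩
    rintro R ⟨y, hy, hne⟩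
    exact ⟨R.2.1, R.2.2, y, hy, Real.toNNReal_pos.1 (pos_iff_ne_zero.2 hne)⟩

variable (h𝒟 : IsLattice 𝒟) (hη : ∀ R ∈ 𝒟, IsCutoff R (η R)) (hq : 1 < q)

lemma wolff_eq : wolff 𝒟 η α q = (latticeKernel h𝒟 hη α hq).wolff := by
  funext μ z
  refine tsum_congr fun R => ?_
  have hp : 0 ≤ q.conjExponent - 1 := (latticeKernel h𝒟 hη α hq).p_sub_one_pos.le
  rw [ENNReal.mul_rpow_of_nonneg _ _ hp, ENNReal.ofReal, ← ENNReal.coe_rpow_of_nonneg _ hp]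
  rfl

lemma energy_eq : energy 𝒟 η α q = (latticeKernel h𝒟 hη α hq).energy := by
  funext μ
  rw [energy, wolff_eq h𝒟 hη hq]
  rfl

lemma capCompact_eq : capCompact 𝒟 η α q = (latticeKernel h𝒟 hη α hq).capCompact := by
  funext K
  rw [capCompact, energy_eq h𝒟 hη hq]
  rfl

lemma capInner_eq : capInner 𝒟 η α q = (latticeKernel h𝒟 hη α hq).capInner := by
  funext K
  rw [capInner, capCompact_eq h𝒟 hη hq]
  rfl

lemma cap_eq : cap 𝒟 η α q = (latticeKernel h𝒟 hη α hq).cap := by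
  funext K
  rw [cap, capInner_eq h𝒟 hη hq]
  rfl

lemma infEnergy_eq : infEnergy 𝒟 η α q = (latticeKernel h𝒟 hη α hq).infEnergy := by
  funext E
  simp only [infEnergy, WolffGeOneQE, cap_eq h𝒟 hη hq, energy_eq h𝒟 hη hq, wolff_eq h𝒟 hη hq]
  rfl

lemma supMass_eq : supMass 𝒟 η α q = (latticeKernel h𝒟 hη α hq).supMass := by
  funext E
  simp only [supMass, wolff_eq h𝒟 hη hq]
  rfl

end ParabolicCapacity

end

theorem theorem4p5 (d : ℕ) (hd : 2 ≤ d) (α q : ℝ)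
    (hα : 0 < α) (hαn : α < (d : ℝ) + 2) (hq : 1 < q) (hqn : q ≤ ((d : ℝ) + 2) / α)
    (𝒟 : Set (ParabolicCapacity.Rect d)) (h𝒟 : ParabolicCapacity.IsLattice 𝒟)
    (η : ParabolicCapacity.Rect d → ParabolicCapacity.SpaceTime d → ℝ)
    (hη : ∀ R ∈ 𝒟, ParabolicCapacity.IsCutoff R (η R)) :
    -- compact sets, with the capacity as defined on compact sets
    (∀ μ ∈ ParabolicCapacity.radon d, ParabolicCapacity.energy 𝒟 η α q μ < ⊤ →
      ∀ ϑ : ℝ, 0 < ϑ →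
        (∀ K : Set (ParabolicCapacity.SpaceTime d), IsCompact K →
          K ⊆ ParabolicCapacity.superlevel 𝒟 η α q μ ϑ →
          ParabolicCapacity.capCompact 𝒟 η α q K ≤
            ENNReal.ofReal (ϑ ^ (-q)) * ParabolicCapacity.energy 𝒟 η α q μ) ∧
        ParabolicCapacity.cap 𝒟 η α q (ParabolicCapacity.superlevel 𝒟 η α q μ ϑ) ≤
          ENNReal.ofReal (ϑ ^ (-q)) * ParabolicCapacity.energy 𝒟 η α q μ) ∧
    (∀ K : Set (ParabolicCapacity.SpaceTime d), IsCompact K →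
      ParabolicCapacity.capCompact 𝒟 η α q K = ParabolicCapacity.infEnergy 𝒟 η α q K) ∧
    (∀ K : Set (ParabolicCapacity.SpaceTime d), IsCompact K →
      ParabolicCapacity.capCompact 𝒟 η α q K = ParabolicCapacity.supMass 𝒟 η α q K) ∧
    -- arbitrary sets, with the extended capacity
    (∀ μ ∈ ParabolicCapacity.radon d, ParabolicCapacity.energy 𝒟 η α q μ < ⊤ →
      ∀ ϑ : ℝ, 0 < ϑ → ∀ E : Set (ParabolicCapacity.SpaceTime d),
        E ⊆ ParabolicCapacity.superlevel 𝒟 η α q μ ϑ →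
        ParabolicCapacity.cap 𝒟 η α q E ≤
          ENNReal.ofReal (ϑ ^ (-q)) * ParabolicCapacity.energy 𝒟 η α q μ) ∧
    (∀ E : Set (ParabolicCapacity.SpaceTime d),
      ParabolicCapacity.cap 𝒟 η α q E = ParabolicCapacity.infEnergy 𝒟 η α q E) ∧
    (∀ E : Set (ParabolicCapacity.SpaceTime d),
      ParabolicCapacity.capInner 𝒟 η α q E = ParabolicCapacity.supMass 𝒟 η α q E) ∧
    (∀ E : Set (ParabolicCapacity.SpaceTime d), MeasureTheory.AnalyticSet E →
      ParabolicCapacity.cap 𝒟 η α q E = ParabolicCapacity.supMass 𝒟 η α q E) := by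
  have : Countable {R : ParabolicCapacity.Rect d // R ∈ 𝒟 ∧ R.side < 1} :=
    (h𝒟.countable.mono (sep_subset 𝒟 fun R => R.side < 1)).to_subtype
  rw [ParabolicCapacity.cap_eq h𝒟 hη hq, ParabolicCapacity.capInner_eq h𝒟 hη hq,
    ParabolicCapacity.capCompact_eq h𝒟 hη hq, ParabolicCapacity.energy_eq h𝒟 hη hq,
    ParabolicCapacity.infEnergy_eq h𝒟 hη hq, ParabolicCapacity.supMass_eq h𝒟 hη hq]
  set k := ParabolicCapacity.latticeKernel h𝒟 hη α hq with hk
  have hweak : ∀ (μ : Measure (ParabolicCapacity.SpaceTime d)) (ϑ : ℝ), 0 < ϑ →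
      (ENNReal.ofReal ϑ)⁻¹ ^ k.q * k.modular (fun i => k.coeff μ i ^ (k.p - 1)) =
        ENNReal.ofReal (ϑ ^ (-q)) * k.energy μ := fun μ ϑ hϑ => by
    rw [k.modular_wolff, ← ENNReal.ofReal_inv_of_pos hϑ,
      ENNReal.ofReal_rpow_of_pos (inv_pos.2 hϑ), Real.inv_rpow hϑ.le, ← Real.rpow_neg hϑ.le]
    rfl
  have hsup : ∀ (μ : Measure (ParabolicCapacity.SpaceTime d)) (ϑ : ℝ),
      ParabolicCapacity.superlevel 𝒟 η α q μ ϑ = {z | ENNReal.ofReal ϑ < k.wolff μ z} :=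
    fun μ ϑ => by rw [ParabolicCapacity.superlevel, ParabolicCapacity.wolff_eq h𝒟 hη hq]
  have hcap : ∀ (μ : Measure (ParabolicCapacity.SpaceTime d)) (ϑ : ℝ), 0 < ϑ →
      k.cap (ParabolicCapacity.superlevel 𝒟 η α q μ ϑ) ≤
        ENNReal.ofReal (ϑ ^ (-q)) * k.energy μ := fun μ ϑ hϑ => by
    rw [← hweak μ ϑ hϑ, hsup]
    exact k.cap_superlevel_le _ (ENNReal.ofReal_pos.2 hϑ).ne' ENNReal.ofReal_ne_top
  refine ⟨fun μ _ _ ϑ hϑ => ⟨fun K hK hKs => ?_, hcap μ ϑ hϑ⟩, fun K hK => ?_, fun K hK => ?_,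
    fun μ _ _ ϑ hϑ E hE => (k.cap_mono hE).trans (hcap μ ϑ hϑ), k.cap_eq_infEnergy,
    k.capInner_eq_supMass, fun E hE => ?_⟩
  · rw [← k.cap_of_isCompact hK]
    exact (k.cap_mono hKs).trans (hcap μ ϑ hϑ)
  · rw [← k.cap_of_isCompact hK, k.cap_eq_infEnergy]
  · rw [← k.capInner_of_isCompact hK, k.capInner_eq_supMass]
  · rw [k.cap_eq_capInner_of_analyticSet hE, k.capInner_eq_supMass]
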